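/- Let $d\ge 2$, $\mu>-1/2$, let $B=\{x\in\mathbb R^d:|x|\le 1\}$ be the closed unit ball with interior $B^\circ$, and let $W_\mu$ be the measure on $B$ with density $(1-|x|^2)^{\mu-1/2}$ with respect to Lebesgue measure. All functions are real-valued. For $f\in C^2(B)$ (twice continuously differentiable up to the boundary) put $$\mathcal L_\mu f=-\Delta f+\sum_{i,j=1}^d x_ix_j\,\partial_i\partial_jf+(2\mu+d)\sum_{i=1}^d x_i\,\partial_if ,$$ and consider the form $\mathcal E(f,g)=\int_B(\mathcal L_\mu f)\,g\,dW_\mu$ with domain $C^2(B)\subset L^2(B,W_\mu)$. For $\varphi\in C^1$ and $x\ne0$ put $\partial_r\varphi(x)=\frac{x}{|x|}\cdot\nabla\varphi(x)$ and $\nabla_0\varphi(x)=|x|\nabla\varphi(x)-x\,\partial_r\varphi(x)$. For $f\in L^2_{\rm loc}(B^\circ\setminus\{0\})$, the $L^2$ radial derivative $\partial_rf$ and the $L^2$ spherical gradient $\nabla_0f$ are the ($\mathbb R$-valued, respectively $\mathbb R^d$-valued) functions in $L^2_{\rm loc}(B^\circ\setminus\{0\})$, if they exist, such that for all $\varphi\in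 C^1_c(B^\circ\setminus\{0\})$ $$\int_B\partial_rf\,\varphi\,dx=-\int_Bf\Big(\partial_r\varphi+\frac{d-1}{|x|}\varphi\Big)dx,\qquad \int_B\nabla_0f\,\varphi\,dx=-\int_Bf\Big(\nabla_0\varphi-(d-1)\frac{x}{|x|}\varphi\Big)dx .$$ Let $D(\overline{\mathcal E})$ be the set of all $f\in L^2(B,W_\mu)$ for which $\partial_rf$ and $\nabla_0f$ exist in this sense, $\sqrt{1-|x|^2}\,\partial_rf$ and $|x|^{-1}|\nabla_0f|$ belong to $L^2(B,W_\mu)$, and there are $f_n\in C^2(B)$ such that $f_n-f$, $\sqrt{1-|x|^2}\,\partial_r(f_n-f)$ and $|x|^{-1}|\nabla_0(f_n-f)|$ tend to $0$ in $L^2(B,W_\mu)$. For $f,g\in D(\overline{\mathcal E})$ put $$\Gamma(f,g)(x)=(1-|x|^2)\,\partial_rf(x)\,\partial_rg(x)+\frac1{|x|^2}\,\nabla_0f(x)\cdot\nabla_0g(x),\qquad \overline{\mathcal E}(f,g)=\int_B\Gamma(f,g)\,dW_\mu .$$ Then $(\overline{\mathcal E},D(\overline{\mathcal E}))$ is the closure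 of $(\mathcal E,C^2(B))$, and it is a regular, strongly local Dirichlet form on $L^2(B,W_\mu)$. For all $f,g\in D(\overline{\mathcal E})$ the function $\Gamma(f,g)$ is $W_\mu$-integrable, and the (mutual) energy measure of $f$ and $g$ is $\Gamma(f,g)\,dW_\mu$. Here energy measures are normalized so that $\overline{\mathcal E}(f,g)=\int_B\Gamma(f,g)\,dW_\mu$; that is, the energy measure $\nu_u$ of a bounded $u\in D(\overline{\mathcal E})$ satisfies $\int\varphi\,d\nu_u=\overline{\mathcal E}(u\varphi,u)-\tfrac12\overline{\mathcal E}(u^2,\varphi)$ for all $\varphi\in D(\overline{\mathcal E})\cap C(B)$, the energy measure of a general $u$ is the limit of $\nu_{(-n)\vee(u\wedge n)}$ as $n\to\infty$, and the mutual energy measure of $f$ and $g$ is $\tfrac12(\nu_{f+g}-\nu_f-\nu_g)$. -/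

import Mathlib

open MeasureTheory Filter Topology

noncomputable section

/-! ## Symmetric forms and Dirichlet forms -/

/-- A real-valued form with a domain in `H`. Only the values `val u v` with `u, v ∈ dom` carry
meaning; the algebraic and analytic laws are the predicates below. -/
structure PartialForm (H : Type*) where
  dom : Set H
  val : H → H → ℝ

namespace PartialForm

section Hilbert

variable {H : Type*} [NormedAddCommGroup H] [InnerProductSpace ℝ H]

/-- A symmetric form on `H`: a non-negative definite symmetric bilinear form which is defined on
a dense linear subspace. -/
structure IsSymmetricForm (E : PartialForm H) : Prop where
  zero_mem : (0 : H) ∈ E.dom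
  add_mem : ∀ u ∈ E.dom, ∀ v ∈ E.dom, u + v ∈ E.dom
  smul_mem : ∀ (c : ℝ), ∀ u ∈ E.dom, c • u ∈ E.dom
  dense_dom : Dense E.dom
  symm : ∀ u ∈ E.dom, ∀ v ∈ E.dom, E.val u v = E.val v u
  add_left : ∀ u ∈ E.dom, ∀ v ∈ E.dom, ∀ w ∈ E.dom, E.val (u + v) w = E.val u w + E.val v w
  smul_left : ∀ (c : ℝ), ∀ u ∈ E.dom, ∀ v ∈ E.dom, E.val (c • u) v = c * E.val u v
  nonneg : ∀ u ∈ E.dom, 0 ≤ E.val u u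

/-- The squared norm `E₁(u, u) = E(u, u) + ⟨u, u⟩` of the form domain. -/
def normSq (E : PartialForm H) (u : H) : ℝ := E.val u u + ‖u‖ ^ 2

/-- A closed form: the domain is complete for the norm `E₁^{1/2}`. -/
def IsClosedForm (E : PartialForm H) : Prop :=
  ∀ u : ℕ → H, (∀ n, u n ∈ E.dom) →
    (∀ ε > 0, ∃ N, ∀ m ≥ N, ∀ n ≥ N, E.normSq (u m - u n) < ε) →
    ∃ v ∈ E.dom, Tendsto (fun n => E.normSq (u n - v)) atTop (𝓝 0)

/-- `F` is the closure of `E`: `F` is a closed symmetric form that extends `E`, and the domain of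
`E` is dense in the domain of `F` for the norm `F₁^{1/2}`. Such an `F` is the smallest closed
extension of `E`. -/
structure IsClosureOf (F E : PartialForm H) : Prop where
  symmetric : F.IsSymmetricForm
  closed : F.IsClosedForm
  dom_subset : E.dom ⊆ F.dom
  val_eq : ∀ u ∈ E.dom, ∀ v ∈ E.dom, F.val u v = E.val u v
  dense_core : ∀ u ∈ F.dom, ∀ ε > 0, ∃ v ∈ E.dom, F.normSq (u - v) < ε

end Hilbert

section L2

variable {X : Type*} [MeasurableSpace X] {m : Measure X}

/-- A Dirichlet form on `L²(X, m)`: a closed symmetric form on which the unit contraction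
`u ↦ (0 ∨ u) ∧ 1` operates. -/
structure IsDirichletForm (E : PartialForm (Lp ℝ 2 m)) : Prop where
  symmetric : E.IsSymmetricForm
  closed : E.IsClosedForm
  markov : ∀ u ∈ E.dom, ∃ v ∈ E.dom,
    (∀ᵐ x ∂m, v x = min (max (u x) 0) 1) ∧ E.val v v ≤ E.val u u

variable [TopologicalSpace X]

/-- `φ` is a continuous function with compact support, and `u` is its class in the domain. -/
def InCore (E : PartialForm (Lp ℝ 2 m)) (u : Lp ℝ 2 m) (φ : X → ℝ) : Prop :=
  u ∈ E.dom ∧ Continuous φ ∧ HasCompactSupport φ ∧ ∀ᵐ x ∂m, u x = φ x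

/-- Regularity: the continuous compactly supported functions in the domain are dense in the domain
for the norm `E₁^{1/2}`, and dense in the space of all continuous compactly supported functions
for the uniform norm. -/
structure IsRegular (E : PartialForm (Lp ℝ 2 m)) : Prop where
  dense_dom : ∀ u ∈ E.dom, ∀ ε > 0, ∃ v φ, E.InCore v φ ∧ E.normSq (u - v) < ε
  dense_continuous : ∀ φ : X → ℝ, Continuous φ → HasCompactSupport φ →
    ∀ ε > 0, ∃ v ψ, E.InCore v ψ ∧ ∀ x, |φ x - ψ x| < ε

/-- The support of the class `u`, i.e. the support of the measure `|u| · m`. -/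
def supp (u : Lp ℝ 2 m) : Set X := (m.withDensity fun x => ‖u x‖ₑ).support

/-- Strong locality: `E(u, v) = 0` whenever `u` and `v` in the domain have compact supports and
`v` is constant (almost everywhere) on a neighbourhood of the support of `u`. -/
def IsStronglyLocal (E : PartialForm (Lp ℝ 2 m)) : Prop :=
  ∀ u ∈ E.dom, ∀ v ∈ E.dom, IsCompact (supp u) → IsCompact (supp v) →
    (∃ U : Set X, IsOpen U ∧ supp u ⊆ U ∧ ∃ c : ℝ, ∀ᵐ x ∂m, x ∈ U → v x = c) →
    E.val u v = 0

/-- `ν` is the energy measure of the bounded element `u` of the domain: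
`∫ φ dν = E(u φ, u) - E(u², φ) / 2` for all continuous compactly supported `φ` in the domain. -/
def IsBoundedEnergyMeasure (E : PartialForm (Lp ℝ 2 m)) (u : Lp ℝ 2 m) (ν : Measure X) : Prop :=
  IsFiniteMeasure ν ∧ ∀ w φ, E.InCore w φ →
    ∃ p ∈ E.dom, ∃ q ∈ E.dom, (∀ᵐ x ∂m, p x = u x * φ x) ∧ (∀ᵐ x ∂m, q x = u x ^ 2) ∧
      ∫ x, φ x ∂ν = E.val p u - E.val q w / 2

/-- `ν` is the energy measure of the (possibly unbounded) element `u` of the domain: the limit of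
the energy measures of the truncations `(-n) ∨ (u ∧ n)`. -/
def IsEnergyMeasure (E : PartialForm (Lp ℝ 2 m)) (u : Lp ℝ 2 m) (ν : Measure X) : Prop :=
  IsFiniteMeasure ν ∧ ∃ (un : ℕ → Lp ℝ 2 m) (νn : ℕ → Measure X),
    (∀ n, un n ∈ E.dom ∧ (∀ᵐ x ∂m, un n x = max (-(n : ℝ)) (min (u x) n)) ∧
      E.IsBoundedEnergyMeasure (un n) (νn n)) ∧
    ∀ A, MeasurableSet A → Tendsto (fun n => νn n A) atTop (𝓝 (ν A))

/-- `s` is the mutual energy measure `Γ(u, v)`, obtained by polarization: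
`Γ(u, v) = (Γ(u + v, u + v) - Γ(u, u) - Γ(v, v)) / 2`. -/
def IsMutualEnergyMeasure (E : PartialForm (Lp ℝ 2 m)) (u v : Lp ℝ 2 m)
    (s : SignedMeasure X) : Prop :=
  ∃ (α β γ : Measure X) (_ : IsFiniteMeasure α) (_ : IsFiniteMeasure β) (_ : IsFiniteMeasure γ),
    E.IsEnergyMeasure (u + v) α ∧ E.IsEnergyMeasure u β ∧ E.IsEnergyMeasure v γ ∧
      s = (1 / 2 : ℝ) • (α.toSignedMeasure - β.toSignedMeasure - γ.toSignedMeasure)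

end L2

end PartialForm

/-! ## The unit ball -/

namespace UnitBall

/-- The Euclidean space of dimension `d`. -/
abbrev Space (d : ℕ) : Type := EuclideanSpace ℝ (Fin d)

/-- The closed Euclidean unit ball `B` as a subset of the space. -/
abbrev ballSet (d : ℕ) : Set (Space d) := Metric.closedBall (0 : Space d) 1

/-- The closed Euclidean unit ball `B` as a space of its own. -/
abbrev Ball (d : ℕ) : Type := ↥(ballSet d)

/-- Lebesgue measure on `B`. -/
def lebesgue (d : ℕ) : Measure (Ball d) :=
  (volume : Measure (Space d)).comap Subtype.val

/-- The measure `(1 - |x|²)^{μ - 1/2} dx` on `B`. -/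
def weightMeasure (d : ℕ) (μ : ℝ) : Measure (Ball d) :=
  (lebesgue d).withDensity
    fun x => ENNReal.ofReal ((1 - ‖(x : Space d)‖ ^ 2) ^ (μ - 1 / 2))

/-- The Hilbert space `L²(B, W_μ)`. -/
abbrev L2 (d : ℕ) (μ : ℝ) : Type := ↥(Lp ℝ 2 (weightMeasure d μ))

variable {d : ℕ}

/-- The space `C²(B)`: functions that are twice continuously differentiable up to the boundary.
Values outside `B` play no role. -/
def IsC2 (f : Space d → ℝ) : Prop := ContDiffOn ℝ 2 f (ballSet d)

/-- The partial derivative `∂ᵢ f` on `B` (one-sided at the boundary). -/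
def partialDeriv (i : Fin d) (f : Space d → ℝ) (x : Space d) : ℝ :=
  fderivWithin ℝ f (ballSet d) x (EuclideanSpace.single i 1)

/-- The differential operator
`L_μ f = -Δ f + ∑ᵢⱼ xᵢ xⱼ ∂ᵢ∂ⱼ f + (2μ + d) ∑ᵢ xᵢ ∂ᵢ f`. -/
def diffOp (μ : ℝ) (f : Space d → ℝ) (x : Space d) : ℝ :=
  - ∑ i, partialDeriv i (partialDeriv i f) x
    + ∑ i, ∑ j, x i * x j * partialDeriv i (partialDeriv j f) x
    + (2 * μ + d) * ∑ i, x i * partialDeriv i f x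

/-- The class `u` has the representative `f ∈ C²(B)`. -/
def IsC2Rep {μ : ℝ} (u : L2 d μ) (f : Space d → ℝ) : Prop :=
  IsC2 f ∧ ∀ᵐ x ∂(weightMeasure d μ), u x = f x

open Classical in
/-- The form `E(f, g) = ⟨L_μ f, g⟩` with domain `C²(B) ⊆ L²(B, W_μ)`. The representative of `u`
in `C²(B)` is unique on `B`. -/
def preForm (d : ℕ) (μ : ℝ) : PartialForm (L2 d μ) where
  dom := {u | ∃ f, IsC2Rep u f}
  val u v := if h : ∃ f, IsC2Rep u f then
    ∫ x, diffOp μ h.choose (x : Space d) * v x ∂(weightMeasure d μ) else 0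

/-! ### Weak radial derivative and weak spherical gradient -/

/-- The classical radial derivative `∂_r φ (x) = ∑ⱼ (xⱼ / |x|) ∂ⱼ φ (x)`. -/
def classicalRadialDeriv (φ : Space d → ℝ) (x : Space d) : ℝ :=
  fderiv ℝ φ x (‖x‖⁻¹ • x)

/-- The classical spherical gradient `∇₀ φ (x) = |x| ∇φ (x) - x ∂_r φ (x)`. -/
def classicalSphGrad (φ : Space d → ℝ) (x : Space d) : Space d :=
  ‖x‖ • gradient φ x - classicalRadialDeriv φ x • x

/-- Test functions: `C¹` with compact support in the punctured open unit ball. -/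
def IsTest (φ : Space d → ℝ) : Prop :=
  ContDiff ℝ 1 φ ∧ HasCompactSupport φ ∧ tsupport φ ⊆ Metric.ball 0 1 \ {0}

/-- The space `L²_loc` of the punctured open unit ball (with respect to Lebesgue measure). -/
def IsL2Loc {F : Type*} [NormedAddCommGroup F] (h : Ball d → F) : Prop :=
  ∀ K : Set (Space d), IsCompact K → K ⊆ Metric.ball 0 1 \ {0} →
    MemLp h 2 ((lebesgue d).restrict {x | (x : Space d) ∈ K})

/-- `h` is the radial derivative of `f` in the `L²` distribution sense. -/
def HasRadialDeriv (f h : Ball d → ℝ) : Prop :=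
  IsL2Loc f ∧ IsL2Loc h ∧ ∀ φ : Space d → ℝ, IsTest φ →
    ∫ x, h x * φ x ∂(lebesgue d) =
      - ∫ x, f x * (classicalRadialDeriv φ (x : Space d)
          + ((d : ℝ) - 1) / ‖(x : Space d)‖ * φ x) ∂(lebesgue d)

/-- `h` is the spherical gradient of `f` in the `L²` distribution sense. -/
def HasSphGrad (f : Ball d → ℝ) (h : Ball d → Space d) : Prop :=
  IsL2Loc f ∧ IsL2Loc h ∧ ∀ φ : Space d → ℝ, IsTest φ →
    ∫ x, φ (x : Space d) • h x ∂(lebesgue d) =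
      - ∫ x, f x • (classicalSphGrad φ (x : Space d)
          - (((d : ℝ) - 1) * φ x) • (‖(x : Space d)‖⁻¹ • (x : Space d))) ∂(lebesgue d)

open Classical in
/-- The `L²` radial derivative `∂_r f` (unique almost everywhere; `0` if it does not exist). -/
def radialDeriv (f : Ball d → ℝ) : Ball d → ℝ :=
  if h : ∃ g, HasRadialDeriv f g then h.choose else 0

open Classical in
/-- The `L²` spherical gradient `∇₀ f` (unique almost everywhere; `0` if it does not exist). -/
def sphGrad (f : Ball d → ℝ) : Ball d → Space d :=
  if h : ∃ g, HasSphGrad f g then h.choose else 0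

/-- The weighted radial derivative `√(1 - |x|²) ∂_r f`. -/
def weightedRadialDeriv (f : Ball d → ℝ) (x : Ball d) : ℝ :=
  √(1 - ‖(x : Space d)‖ ^ 2) * radialDeriv f x

/-- The weighted spherical gradient `|x|⁻¹ ∇₀ f`. -/
def weightedSphGrad (f : Ball d → ℝ) (x : Ball d) : Space d :=
  ‖(x : Space d)‖⁻¹ • sphGrad f x

/-- The energy density
`Γ(f, g) = (1 - |x|²) ∂_r f ∂_r g + |x|⁻² ∇₀ f · ∇₀ g`. -/
def energyDensity (f g : Ball d → ℝ) (x : Ball d) : ℝ :=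
  (1 - ‖(x : Space d)‖ ^ 2) * (radialDeriv f x * radialDeriv g x)
    + (‖(x : Space d)‖ ^ 2)⁻¹ * inner ℝ (sphGrad f x) (sphGrad g x)

/-- The form `∫_B Γ(f, g) dW_μ` on the space of all `f ∈ L²(B, W_μ)` whose `L²` radial derivative
and spherical gradient exist, with `√(1 - |x|²) ∂_r f` and `|x|⁻¹ |∇₀ f|` in `L²(B, W_μ)`, and
which can be approximated by functions `fₙ ∈ C²(B)`. -/
def closedForm (d : ℕ) (μ : ℝ) : PartialForm (L2 d μ) where
  dom := {f |
    (∃ g, HasRadialDeriv f g) ∧ (∃ g, HasSphGrad f g) ∧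
    MemLp (weightedRadialDeriv f) 2 (weightMeasure d μ) ∧
    MemLp (weightedSphGrad f) 2 (weightMeasure d μ) ∧
    ∃ F : ℕ → Space d → ℝ, (∀ n, IsC2 (F n)) ∧
      Tendsto (fun n => eLpNorm (fun x : Ball d => F n x - f x) 2 (weightMeasure d μ))
        atTop (𝓝 0) ∧
      Tendsto (fun n => eLpNorm (weightedRadialDeriv fun x : Ball d => F n x - f x) 2
        (weightMeasure d μ)) atTop (𝓝 0) ∧
      Tendsto (fun n => eLpNorm (weightedSphGrad fun x : Ball d => F n x - f x) 2
        (weightMeasure d μ)) atTop (𝓝 0)}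
  val f g := ∫ x, energyDensity f g x ∂(weightMeasure d μ)

end UnitBall

end

noncomputable section

/-! ### Square integrable functions with values in an inner product space -/

namespace MeasureTheory

variable {X : Type*} [MeasurableSpace X] {m : Measure X}
  {V : Type*} [NormedAddCommGroup V] [InnerProductSpace ℝ V]

/-! The form is the square of a closed gradient. Put `Z = (√(1 - |x|²) ∂_r f, |x|⁻¹ ∇₀ f)`. For `f,
g ∈ C²(B)` the inner product of these weighted gradients is `∇f · ∇g - (x · ∇f)(x · ∇g)`, in which
the singularity at the origin has cancelled. Green's formula `∫ (L_μ f) g dW_μ = ∫ ⟨Z_f, Z_g⟩ dW_μ`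
follows from the identity `div(W P) = -W L_μ f` for the field `P = ∇f - (x · ∇f) x` and the weight
`W = (1 - |x|²)^{μ - 1/2}`. There is no boundary term because `x · P = (1 - |x|²) (x · ∇f)` vanishes
on the sphere: along cut-off functions that rise within distance of order `1/n` from the sphere, the
error stays bounded and tends to `0` pointwise, and `W_μ` is a finite measure as `μ > -1/2`
(`integral_diffOp_mul`).

Let `G` be the closure in `L² × L²` of the graph `{(f, Z_f) : f ∈ C²(B)}`. Testing against functions
supported in the punctured open ball is continuous for the graph norm, so for every `(u, Z) ∈ G` the
two components of `Z` are, up to their weights, the weak derivatives of `u`. These are unique, hence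
`G` is again the graph of an operator (closability). The approximation clause in the definition of
the domain says exactly that `u` is a first component of `G` (`mem_dom_of_mem`, `mem_of_mem_dom`).

Everything else is abstract and uses only that `G` is closed and obeys the chain rule for `C²`
functions with bounded derivative (`IsGradientForm`). By approximation the chain rule extends to the
truncations `t ↦ a ∨ (t ∧ b)` with derivative the indicator function of `(a, b)`, which gives the
Markov property. Truncating to intervals that shrink to `c` shows that `Z` vanishes on `{u = c}`
(`grad_eq_zero_of_level`), which gives strong locality. The Leibniz rule for bounded functions
identifies the energy measure of `u` as `|Z|² dW_μ`; truncation and polarization do the rest.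
Regularity is Stone–Weierstrass on the compact ball. -/

theorem L2.norm_sq_eq_integral (f : Lp V 2 m) : ‖f‖ ^ 2 = ∫ x, ‖f x‖ ^ 2 ∂m := by
  rw [← real_inner_self_eq_norm_sq, L2.inner_def]
  simp only [real_inner_self_eq_norm_sq]

/-- Dominated convergence in `L²`. -/
theorem L2.tendsto_of_dominated {F : ℕ → Lp V 2 m} {f : Lp V 2 m} {g : X → ℝ}
    (hg : MemLp g 2 m) (hb : ∀ n, ∀ᵐ x ∂m, ‖F n x‖ ≤ g x)
    (hl : ∀ᵐ x ∂m, Tendsto (fun n => F n x) atTop (𝓝 (f x))) :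
    Tendsto F atTop (𝓝 f) := by
  rw [tendsto_iff_norm_sub_tendsto_zero]
  have hf : ∀ᵐ x ∂m, ‖f x‖ ≤ g x := by
    filter_upwards [hl, ae_all_iff.2 hb] with x hx hbx
    exact le_of_tendsto hx.norm (Eventually.of_forall hbx)
  have key : Tendsto (fun n => ‖F n - f‖ ^ 2) atTop (𝓝 0) := by
    have h0 : (0 : ℝ) = ∫ _, (0 : ℝ) ∂m := by simp
    simp only [L2.norm_sq_eq_integral]
    rw [h0]
    refine tendsto_integral_of_dominated_convergence (fun x => (2 * g x) ^ 2) (fun n => ?_)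
      ?_ (fun n => ?_) ?_
    · exact (Lp.aestronglyMeasurable _).norm.pow 2
    · exact (hg.const_mul 2).integrable_sq
    · filter_upwards [hb n, hf, Lp.coeFn_sub (F n) f] with x h1 h2 h3
      rw [h3, Pi.sub_apply, Real.norm_of_nonneg (by positivity)]
      have := norm_sub_le (F n x) (f x)
      gcongr
      linarith
    · filter_upwards [hl, ae_all_iff.2 fun n => Lp.coeFn_sub (F n) f] with x h1 h2
      have h3 : Tendsto (fun n => ‖F n x - f x‖ ^ 2) atTop (𝓝 (‖f x - f x‖ ^ 2)) :=
        ((h1.sub_const _).norm).pow 2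
      simpa only [h2, Pi.sub_apply, sub_self, norm_zero, ne_eq, OfNat.ofNat_ne_zero,
        not_false_eq_true, zero_pow] using h3
  have := key.sqrt
  simpa [Real.sqrt_sq (norm_nonneg _)] using this

theorem Lp.memLp_smul_of_bounded {a : X → ℝ} (ha : AEStronglyMeasurable a m) {C : ℝ}
    (hC : ∀ᵐ x ∂m, |a x| ≤ C) (Z : Lp V 2 m) : MemLp (fun x => a x • Z x) 2 m := by
  refine (Lp.memLp Z).of_le_mul (c := C) (ha.smul (Lp.aestronglyMeasurable Z)) ?_
  filter_upwards [hC] with x hx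
  rw [norm_smul, Real.norm_eq_abs]
  gcongr

end MeasureTheory

/-! ### The chain rule and its limits -/

namespace PartialForm

variable {X : Type*} [MeasurableSpace X] {m : Measure X}
  {V : Type*} [NormedAddCommGroup V] [InnerProductSpace ℝ V]

/-- `q` is the composition `(φ ∘ u, (φ' ∘ u) • Z)` of the pair `p = (u, Z)` of a function and
its gradient. -/
def IsComp (φ φ' : ℝ → ℝ) (p q : Lp ℝ 2 m × Lp V 2 m) : Prop :=
  (∀ᵐ x ∂m, q.1 x = φ (p.1 x)) ∧ ∀ᵐ x ∂m, q.2 x = φ' (p.1 x) • p.2 x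

/-- The set `S` is stable under composition with `φ`, whose derivative is `φ'`. -/
def StableComp (φ φ' : ℝ → ℝ) (S : Set (Lp ℝ 2 m × Lp V 2 m)) : Prop :=
  ∀ p ∈ S, ∃ q ∈ S, IsComp φ φ' p q

theorem abs_sub_le_of_deriv_le {φ φ' : ℝ → ℝ} (hφ : ∀ t, HasDerivAt φ (φ' t) t) {C : ℝ}
    (hC : ∀ t, |φ' t| ≤ C) (s t : ℝ) : |φ s - φ t| ≤ C * |s - t| := by
  have := Convex.norm_image_sub_le_of_norm_hasDerivWithin_le (s := Set.univ) (f := φ) (f' := φ')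
    (C := C) (x := t) (y := s) (fun x _ => (hφ x).hasDerivWithinAt)
    (fun x _ => by simpa using hC x) convex_univ trivial trivial
  simpa using this

/-- For `(uₙ, Zₙ) → (u, Z)` the first components converge because `φ` is Lipschitz. In the second,
`φ'(uₙ)(Zₙ - Z)` is small since `φ'` is bounded, and `φ'(uₙ) Z → φ'(u) Z` by dominated convergence.
-/
theorem StableComp.closure [IsFiniteMeasure m] {φ φ' : ℝ → ℝ} {S : Set (Lp ℝ 2 m × Lp V 2 m)}
    (hS : StableComp φ φ' S) (hφ : ∀ t, HasDerivAt φ (φ' t) t) (hφ' : Continuous φ') {C : ℝ}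
    (hC : ∀ t, |φ' t| ≤ C) : StableComp φ φ' (closure S) := by
  intro p hp
  have hlip := abs_sub_le_of_deriv_le hφ hC
  have hφc : Continuous φ := continuous_iff_continuousAt.2 fun t => (hφ t).continuousAt
  obtain ⟨s, hs, hlim⟩ := mem_closure_iff_seq_limit.1 hp
  have h1 : Tendsto (fun n => (s n).1) atTop (𝓝 p.1) := (continuous_fst.tendsto p).comp hlim
  -- Convergence in `L²` gives convergence almost everywhere along a subsequence; continuity of `φ'`
  -- can only be used pointwise.
  obtain ⟨ns, hns, hae⟩ := (tendstoInMeasure_of_tendsto_Lp h1).exists_seq_tendsto_ae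
  have hlim' : Tendsto (fun n => s (ns n)) atTop (𝓝 p) := hlim.comp hns.tendsto_atTop
  have h1' : Tendsto (fun n => (s (ns n)).1) atTop (𝓝 p.1) := h1.comp hns.tendsto_atTop
  have h2' : Tendsto (fun n => (s (ns n)).2) atTop (𝓝 p.2) :=
    (continuous_snd.tendsto p).comp hlim'
  choose q hqS hq1 hq2 using fun n => hS (s (ns n)) (hs _)
  have hmul : ∀ u : Lp ℝ 2 m, MemLp (fun x => φ' (u x) • p.2 x) 2 m := fun u =>
    Lp.memLp_smul_of_bounded (hφ'.comp_aestronglyMeasurable (Lp.aestronglyMeasurable u))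
      (Eventually.of_forall fun x => hC _) p.2
  have hL1 : MemLp (fun x => φ (p.1 x)) 2 m := by
    have hg : MemLp (fun x => C * |p.1 x| + |φ 0|) 2 m :=
      ((Lp.memLp p.1).abs.const_mul C).add (memLp_const _)
    refine hg.of_le (hφc.comp_aestronglyMeasurable (Lp.aestronglyMeasurable p.1))
      (Eventually.of_forall fun x => ?_)
    have h3 := hlip (p.1 x) 0
    have h4 := abs_sub_abs_le_abs_sub (φ (p.1 x)) (φ 0)
    rw [sub_zero] at h3
    simp only [Real.norm_eq_abs]
    refine le_trans ?_ (le_abs_self _)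
    linarith
  refine ⟨(hL1.toLp _, (hmul p.1).toLp _), ?_, hL1.coeFn_toLp, (hmul p.1).coeFn_toLp⟩
  refine mem_closure_iff_seq_limit.2 ⟨q, hqS, ?_⟩
  refine Prod.tendsto_iff _ _ |>.2 ⟨?_, ?_⟩
  · rw [tendsto_iff_norm_sub_tendsto_zero] at h1' ⊢
    refine squeeze_zero (fun n => norm_nonneg _) (fun n => ?_) (by simpa using h1'.const_mul C)
    refine Lp.norm_le_mul_norm_of_ae_le_mul ?_
    filter_upwards [hq1 n, hL1.coeFn_toLp, Lp.coeFn_sub (q n).1 (hL1.toLp _),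
      Lp.coeFn_sub (s (ns n)).1 p.1] with x e1 e2 e3 e4
    rw [e3, e4, Pi.sub_apply, Pi.sub_apply, e1, e2]
    exact hlip _ _
  · have hr : Tendsto (fun n => (hmul (s (ns n)).1).toLp _) atTop (𝓝 ((hmul p.1).toLp _)) := by
      refine L2.tendsto_of_dominated (g := fun x => C * ‖p.2 x‖)
        ((Lp.memLp p.2).norm.const_mul C) (fun n => ?_) ?_
      · filter_upwards [(hmul (s (ns n)).1).coeFn_toLp] with x e1
        rw [e1, norm_smul]
        exact mul_le_mul_of_nonneg_right (hC _) (norm_nonneg _)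
      · filter_upwards [ae_all_iff.2 fun n => (hmul (s (ns n)).1).coeFn_toLp,
          (hmul p.1).coeFn_toLp, hae] with x e1 e2 e3
        rw [e2]
        simp only [e1]
        exact ((hφ'.tendsto _).comp e3).smul_const _
    have hd : Tendsto (fun n => (q n).2 - (hmul (s (ns n)).1).toLp _) atTop (𝓝 0) := by
      rw [tendsto_iff_norm_sub_tendsto_zero] at h2'
      rw [tendsto_zero_iff_norm_tendsto_zero]
      refine squeeze_zero (fun n => norm_nonneg _) (fun n => ?_) (by simpa using h2'.const_mul C)
      refine Lp.norm_le_mul_norm_of_ae_le_mul ?_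
      filter_upwards [hq2 n, (hmul (s (ns n)).1).coeFn_toLp,
        Lp.coeFn_sub (q n).2 ((hmul (s (ns n)).1).toLp _),
        Lp.coeFn_sub (s (ns n)).2 p.2] with x e1 e2 e3 e4
      rw [e3, e4, Pi.sub_apply, Pi.sub_apply, e1, e2, ← smul_sub, norm_smul]
      exact mul_le_mul_of_nonneg_right (hC _) (norm_nonneg _)
    simpa using hd.add hr

/-- Here the pair `(u, Z)` is fixed and the function varies. The bounds `D + |u|` and `C ‖Z‖` are
square integrable, so pointwise convergence is enough. The limit `ψ'` may be discontinuous and need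
not be a derivative of `ψ` everywhere. -/
theorem StableComp.of_tendsto [IsFiniteMeasure m] {φ φ' : ℕ → ℝ → ℝ} {ψ ψ' : ℝ → ℝ}
    {S : Set (Lp ℝ 2 m × Lp V 2 m)} (hcl : IsClosed S) (hS : ∀ n, StableComp (φ n) (φ' n) S)
    {C D : ℝ} (hD : ∀ n t, |φ n t| ≤ D + |t|) (hC : ∀ n t, |φ' n t| ≤ C)
    (hφ : ∀ t, Tendsto (fun n => φ n t) atTop (𝓝 (ψ t)))
    (hφ' : ∀ t, Tendsto (fun n => φ' n t) atTop (𝓝 (ψ' t))) : StableComp ψ ψ' S := by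
  intro p hp
  choose q hqS hq1 hq2 using fun n => hS n p hp
  have ha1 := ae_all_iff.2 hq1
  have ha2 := ae_all_iff.2 hq2
  have l1 : ∀ᵐ x ∂m, Tendsto (fun n => (q n).1 x) atTop (𝓝 (ψ (p.1 x))) := by
    filter_upwards [ha1] with x h
    simpa only [h] using hφ _
  have l2 : ∀ᵐ x ∂m, Tendsto (fun n => (q n).2 x) atTop (𝓝 (ψ' (p.1 x) • p.2 x)) := by
    filter_upwards [ha2] with x h
    simpa only [h] using (hφ' _).smul_const _
  have g1 : MemLp (fun x => D + |p.1 x|) 2 m := (memLp_const D).add (Lp.memLp p.1).abs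
  have g2 : MemLp (fun x => C * ‖p.2 x‖) 2 m := (Lp.memLp p.2).norm.const_mul C
  have b1 : ∀ n, ∀ᵐ x ∂m, ‖(q n).1 x‖ ≤ D + |p.1 x| := fun n => by
    filter_upwards [hq1 n] with x h
    rw [h]
    exact hD _ _
  have b2 : ∀ n, ∀ᵐ x ∂m, ‖(q n).2 x‖ ≤ C * ‖p.2 x‖ := fun n => by
    filter_upwards [hq2 n] with x h
    rw [h, norm_smul]
    exact mul_le_mul_of_nonneg_right (hC _ _) (norm_nonneg _)
  have hL1 : MemLp (fun x => ψ (p.1 x)) 2 m := by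
    refine g1.of_le (aestronglyMeasurable_of_tendsto_ae atTop
      (fun n => Lp.aestronglyMeasurable (q n).1) l1) ?_
    filter_upwards [ae_all_iff.2 b1, l1] with x h1 h2
    exact (le_of_tendsto h2.norm (Eventually.of_forall h1)).trans (le_abs_self _)
  have hL2 : MemLp (fun x => ψ' (p.1 x) • p.2 x) 2 m := by
    refine g2.of_le (aestronglyMeasurable_of_tendsto_ae atTop
      (fun n => Lp.aestronglyMeasurable (q n).2) l2) ?_
    filter_upwards [ae_all_iff.2 b2, l2] with x h1 h2
    exact (le_of_tendsto h2.norm (Eventually.of_forall h1)).trans (le_abs_self _)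
  refine ⟨(hL1.toLp _, hL2.toLp _), ?_, hL1.coeFn_toLp, hL2.coeFn_toLp⟩
  refine hcl.mem_of_tendsto (b := atTop) (f := q) ?_ (Eventually.of_forall hqS)
  refine Prod.tendsto_iff _ _ |>.2 ⟨L2.tendsto_of_dominated g1 b1 ?_,
    L2.tendsto_of_dominated g2 b2 ?_⟩
  · filter_upwards [l1, hL1.coeFn_toLp] with x h1 h2
    rwa [h2]
  · filter_upwards [l2, hL2.coeFn_toLp] with x h1 h2
    rwa [h2]

/-! ### Truncations -/

/-- Smooth approximations of the indicator function of the interval `(a, b)`. -/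
def smoothIndicator (a b : ℝ) (n : ℕ) (s : ℝ) : ℝ :=
  Real.smoothTransition (n * (s - a)) * Real.smoothTransition (n * (b - s))

theorem contDiff_smoothIndicator (a b : ℝ) (n : ℕ) : ContDiff ℝ 1 (smoothIndicator a b n) := by
  unfold smoothIndicator
  have h := Real.smoothTransition.contDiff (n := 1)
  exact (h.comp (by fun_prop)).mul (h.comp (by fun_prop))

theorem abs_smoothIndicator_le (a b : ℝ) (n : ℕ) (s : ℝ) : |smoothIndicator a b n s| ≤ 1 := by
  unfold smoothIndicator
  rw [abs_of_nonneg (mul_nonneg (Real.smoothTransition.nonneg _) (Real.smoothTransition.nonneg _))]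
  exact mul_le_one₀ (Real.smoothTransition.le_one _) (Real.smoothTransition.nonneg _)
    (Real.smoothTransition.le_one _)

/-- The approximations vanish at both endpoints, so the limit is the indicator of the open interval
at every point, not only almost everywhere. This matters because `u` may charge the levels `a` and
`b`. -/
theorem tendsto_smoothIndicator (a b s : ℝ) :
    Tendsto (fun n => smoothIndicator a b n s) atTop
      (𝓝 ((Set.Ioo a b).indicator (fun _ => 1) s)) := by
  by_cases hs : s ∈ Set.Ioo a b
  · rw [Set.indicator_of_mem hs]
    refine tendsto_const_nhds.congr' ?_
    have h1 : Tendsto (fun n : ℕ => (n : ℝ) * (s - a)) atTop atTop :=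
      tendsto_natCast_atTop_atTop.atTop_mul_const (by linarith [hs.1])
    have h2 : Tendsto (fun n : ℕ => (n : ℝ) * (b - s)) atTop atTop :=
      tendsto_natCast_atTop_atTop.atTop_mul_const (by linarith [hs.2])
    filter_upwards [h1.eventually_ge_atTop 1, h2.eventually_ge_atTop 1] with n e1 e2
    simp [smoothIndicator, Real.smoothTransition.one_of_one_le e1,
      Real.smoothTransition.one_of_one_le e2]
  · rw [Set.indicator_of_notMem hs]
    refine tendsto_const_nhds.congr fun n => ?_
    have hn : (0 : ℝ) ≤ n := n.cast_nonneg
    rcases le_or_gt s a with h | h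
    · simp [smoothIndicator, Real.smoothTransition.zero_of_nonpos
        (mul_nonpos_of_nonneg_of_nonpos hn (sub_nonpos.2 h))]
    · have h' : b ≤ s := not_lt.1 fun h' => hs ⟨h, h'⟩
      simp [smoothIndicator, Real.smoothTransition.zero_of_nonpos
        (mul_nonpos_of_nonneg_of_nonpos hn (sub_nonpos.2 h'))]

/-- Smooth approximations of the truncation `t ↦ a ∨ (t ∧ b)`. -/
def smoothTrunc (a b : ℝ) (n : ℕ) (t : ℝ) : ℝ := a + ∫ s in a..t, smoothIndicator a b n s

theorem hasDerivAt_smoothTrunc (a b : ℝ) (n : ℕ) (t : ℝ) :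
    HasDerivAt (smoothTrunc a b n) (smoothIndicator a b n t) t :=
  ((contDiff_smoothIndicator a b n).continuous.integral_hasStrictDerivAt a t).hasDerivAt.const_add a

theorem deriv_smoothTrunc (a b : ℝ) (n : ℕ) : deriv (smoothTrunc a b n) = smoothIndicator a b n :=
  funext fun t => (hasDerivAt_smoothTrunc a b n t).deriv

/-- Class `C²` is what composition inside `C²(B)` requires; one integration of a `C¹` function
provides it. -/
theorem contDiff_smoothTrunc (a b : ℝ) (n : ℕ) : ContDiff ℝ 2 (smoothTrunc a b n) := by
  have : (2 : WithTop ℕ∞) = 1 + 1 := by norm_num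
  rw [this, contDiff_succ_iff_deriv, deriv_smoothTrunc]
  exact ⟨fun t => (hasDerivAt_smoothTrunc a b n t).differentiableAt, by simp,
    contDiff_smoothIndicator a b n⟩

theorem integral_indicator_Ioo {a b : ℝ} (hab : a ≤ b) (t : ℝ) :
    a + ∫ s in a..t, (Set.Ioo a b).indicator (fun _ => (1 : ℝ)) s = max a (min t b) := by
  rcases le_total t a with h | h
  · rw [min_eq_left (h.trans hab), max_eq_left h, intervalIntegral.integral_of_ge h,
      setIntegral_eq_zero_of_forall_eq_zero]
    · simp
    · intro x hx
      exact Set.indicator_of_notMem (fun h' => absurd h'.1 (not_lt.2 hx.2)) _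
  · rw [intervalIntegral.integral_of_le h, ← integral_Icc_eq_integral_Ioc,
      setIntegral_indicator measurableSet_Ioo, max_eq_right (le_min h hab)]
    have hIcc : Set.Icc a t ∩ Set.Icc a b = Set.Icc a (min t b) := by
      simp [Set.Icc_inter_Icc]
    have hset := ae_eq_set_inter (μ := volume) (ae_eq_refl (Set.Icc a t))
      (Ioo_ae_eq_Icc (a := a) (b := b))
    rw [hIcc] at hset
    rw [setIntegral_congr_set hset]
    simp [h, hab]

theorem tendsto_smoothTrunc {a b : ℝ} (hab : a ≤ b) (t : ℝ) :
    Tendsto (fun n => smoothTrunc a b n t) atTop (𝓝 (max a (min t b))) := by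
  rw [← integral_indicator_Ioo hab]
  refine Tendsto.const_add a ?_
  refine intervalIntegral.tendsto_integral_filter_of_dominated_convergence (fun _ => 1)
    (Eventually.of_forall fun n =>
      (contDiff_smoothIndicator a b n).continuous.aestronglyMeasurable)
    (Eventually.of_forall fun n => Eventually.of_forall fun s _ => abs_smoothIndicator_le a b n s)
    (by simp) (Eventually.of_forall fun s _ => tendsto_smoothIndicator a b s)

theorem abs_smoothTrunc_le (a b : ℝ) (n : ℕ) (t : ℝ) : |smoothTrunc a b n t| ≤ 2 * |a| + |t| := by
  have h := abs_sub_le_of_deriv_le (hasDerivAt_smoothTrunc a b n) (abs_smoothIndicator_le a b n) t a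
  have h0 : smoothTrunc a b n a = a := by simp [smoothTrunc]
  rw [h0] at h
  have h1 := abs_sub_abs_le_abs_sub (smoothTrunc a b n t) a
  have h2 := abs_sub t a
  linarith

/-- `E(u, v) = ∫ ⟨∇u, ∇v⟩ dm` for the closed operator `∇` with graph `G`, which obeys the chain
rule. -/
structure IsGradientForm (E : PartialForm (Lp ℝ 2 m))
    (G : Submodule ℝ (Lp ℝ 2 m × Lp V 2 m)) : Prop where
  closed : IsClosed (G : Set (Lp ℝ 2 m × Lp V 2 m))
  mem_dom : ∀ u, u ∈ E.dom ↔ ∃ Z, (u, Z) ∈ G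
  val_eq : ∀ {u Z v Y}, (u, Z) ∈ G → (v, Y) ∈ G → E.val u v = inner ℝ Z Y
  comp : ∀ φ : ℝ → ℝ, ContDiff ℝ 2 φ → (∃ C, ∀ t, |deriv φ t| ≤ C) →
    StableComp φ (deriv φ) (G : Set (Lp ℝ 2 m × Lp V 2 m))

/-! ### Closedness, the Markov property and locality of gradient forms -/

namespace IsGradientForm

variable {E : PartialForm (Lp ℝ 2 m)} {G : Submodule ℝ (Lp ℝ 2 m × Lp V 2 m)}

theorem val_self (h : E.IsGradientForm G) {u : Lp ℝ 2 m} {Z : Lp V 2 m} (hu : (u, Z) ∈ G) :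
    E.val u u = ‖Z‖ ^ 2 := by
  rw [h.val_eq hu hu, real_inner_self_eq_norm_sq]

theorem normSq_eq (h : E.IsGradientForm G) {u : Lp ℝ 2 m} {Z : Lp V 2 m} (hu : (u, Z) ∈ G) :
    E.normSq u = ‖Z‖ ^ 2 + ‖u‖ ^ 2 := by
  rw [normSq, h.val_self hu]

/-- The value `E(0, 0)` depends on the function alone: it is `0` by the pair `(0, 0)` and `‖Z‖²` by
the pair `(0, Z)`. This is where closability enters the abstract argument. -/
theorem eq_zero_of_zero (h : E.IsGradientForm G) {Z : Lp V 2 m} (hZ : (0, Z) ∈ G) : Z = 0 := by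
  have h0 : ((0 : Lp ℝ 2 m), (0 : Lp V 2 m)) ∈ G := G.zero_mem
  have := h.val_self hZ
  rw [h.val_self h0] at this
  simpa using this.symm

theorem unique (h : E.IsGradientForm G) {u : Lp ℝ 2 m} {Z Y : Lp V 2 m} (hZ : (u, Z) ∈ G)
    (hY : (u, Y) ∈ G) : Z = Y := by
  have : (u, Z) - (u, Y) ∈ G := G.sub_mem hZ hY
  rw [Prod.mk_sub_mk, sub_self] at this
  exact sub_eq_zero.1 (h.eq_zero_of_zero this)

theorem isSymmetricForm (h : E.IsGradientForm G) (hd : Dense E.dom) : E.IsSymmetricForm where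
  zero_mem := (h.mem_dom 0).2 ⟨0, G.zero_mem⟩
  add_mem u hu v hv := by
    obtain ⟨Z, hZ⟩ := (h.mem_dom u).1 hu
    obtain ⟨Y, hY⟩ := (h.mem_dom v).1 hv
    exact (h.mem_dom _).2 ⟨Z + Y, G.add_mem hZ hY⟩
  smul_mem c u hu := by
    obtain ⟨Z, hZ⟩ := (h.mem_dom u).1 hu
    exact (h.mem_dom _).2 ⟨c • Z, G.smul_mem c hZ⟩
  dense_dom := hd
  symm u hu v hv := by
    obtain ⟨Z, hZ⟩ := (h.mem_dom u).1 hu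
    obtain ⟨Y, hY⟩ := (h.mem_dom v).1 hv
    rw [h.val_eq hZ hY, h.val_eq hY hZ, real_inner_comm]
  add_left u hu v hv w hw := by
    obtain ⟨Z, hZ⟩ := (h.mem_dom u).1 hu
    obtain ⟨Y, hY⟩ := (h.mem_dom v).1 hv
    obtain ⟨R, hR⟩ := (h.mem_dom w).1 hw
    rw [h.val_eq hZ hR, h.val_eq hY hR, h.val_eq (G.add_mem hZ hY) hR, inner_add_left]
  smul_left c u hu v hv := by
    obtain ⟨Z, hZ⟩ := (h.mem_dom u).1 hu
    obtain ⟨Y, hY⟩ := (h.mem_dom v).1 hv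
    rw [h.val_eq hZ hY, h.val_eq (G.smul_mem c hZ) hY, real_inner_smul_left]
  nonneg u hu := by
    obtain ⟨Z, hZ⟩ := (h.mem_dom u).1 hu
    rw [h.val_self hZ]
    positivity

/-- The norm `E₁^{1/2}` is equivalent to the norm of the graph, and a closed subspace of a complete
space is complete. -/
theorem isClosedForm [CompleteSpace V] (h : E.IsGradientForm G) : E.IsClosedForm := by
  intro u hu hC
  choose Z hZ using fun n => (h.mem_dom (u n)).1 (hu n)
  have hsub : ∀ i j, (u i - u j, Z i - Z j) ∈ G := fun i j => G.sub_mem (hZ i) (hZ j)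
  have hcau : CauchySeq fun n => (u n, Z n) := by
    rw [Metric.cauchySeq_iff]
    intro ε hε
    obtain ⟨N, hN⟩ := hC (ε ^ 2) (by positivity)
    refine ⟨N, fun i hi j hj => ?_⟩
    have := hN i hi j hj
    rw [h.normSq_eq (hsub i j)] at this
    rw [dist_eq_norm, Prod.mk_sub_mk, Prod.norm_mk]
    refine max_lt ?_ ?_ <;>
    · refine lt_of_pow_lt_pow_left₀ 2 hε.le ?_
      nlinarith [sq_nonneg ‖u i - u j‖, sq_nonneg ‖Z i - Z j‖]
  obtain ⟨⟨v, Y⟩, hlim⟩ := cauchySeq_tendsto_of_complete hcau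
  have hvY : (v, Y) ∈ G := h.closed.mem_of_tendsto hlim (Eventually.of_forall hZ)
  refine ⟨v, (h.mem_dom v).2 ⟨Y, hvY⟩, ?_⟩
  have h1 := (continuous_fst.tendsto _).comp hlim
  have h2 := (continuous_snd.tendsto _).comp hlim
  have h3 : ∀ n, E.normSq (u n - v) = ‖Z n - Y‖ ^ 2 + ‖u n - v‖ ^ 2 := fun n =>
    h.normSq_eq (G.sub_mem (hZ n) hvY)
  simp only [h3]
  have h4 := ((tendsto_iff_norm_sub_tendsto_zero.1 h2).pow 2).add
    ((tendsto_iff_norm_sub_tendsto_zero.1 h1).pow 2)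
  simpa using h4

/-- Closedness of `G` lets the chain rule pass from the smooth truncations to the limit. -/
theorem stableComp_trunc [IsFiniteMeasure m] (h : E.IsGradientForm G) {a b : ℝ} (hab : a ≤ b) :
    StableComp (fun t => max a (min t b)) ((Set.Ioo a b).indicator fun _ => 1)
      (G : Set (Lp ℝ 2 m × Lp V 2 m)) := by
  refine StableComp.of_tendsto (φ := smoothTrunc a b) (φ' := smoothIndicator a b) h.closed
    (fun n => ?_) (abs_smoothTrunc_le a b) (abs_smoothIndicator_le a b) (tendsto_smoothTrunc hab)
    (tendsto_smoothIndicator a b)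
  rw [← deriv_smoothTrunc]
  refine h.comp _ (contDiff_smoothTrunc a b n) ⟨1, ?_⟩
  rw [deriv_smoothTrunc]
  exact abs_smoothIndicator_le a b n

theorem isDirichletForm [IsFiniteMeasure m] [CompleteSpace V] (h : E.IsGradientForm G)
    (hd : Dense E.dom) : E.IsDirichletForm where
  symmetric := h.isSymmetricForm hd
  closed := h.isClosedForm
  markov u hu := by
    obtain ⟨Z, hZ⟩ := (h.mem_dom u).1 hu
    -- The gradient of the truncation is `1_{(0,1)}(u) Z`, pointwise no longer than `Z`.
    obtain ⟨⟨v, Y⟩, hv, h1, h2⟩ := h.stableComp_trunc zero_le_one (u, Z) hZ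
    refine ⟨v, (h.mem_dom v).2 ⟨Y, hv⟩, ?_, ?_⟩
    · filter_upwards [h1] with x hx
      rw [hx]
      rcases le_total 0 (u x) with h0 | h0 <;> simp [h0, zero_le_one.trans']
    · rw [h.val_self hv, h.val_self hZ]
      gcongr
      refine Lp.norm_le_norm_of_ae_le ?_
      filter_upwards [h2] with x hx
      rw [hx, norm_smul]
      refine mul_le_of_le_one_left (norm_nonneg _) ?_
      simp only [Set.indicator]
      split_ifs <;> simp

/-- The gradient of `u` vanishes almost everywhere on every level set of `u`. -/
theorem grad_eq_zero_of_level [IsFiniteMeasure m] (h : E.IsGradientForm G) {u : Lp ℝ 2 m}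
    {Z : Lp V 2 m} (hu : (u, Z) ∈ G) (c : ℝ) : ∀ᵐ x ∂m, u x = c → Z x = 0 := by
  have hpos : ∀ n : ℕ, (0 : ℝ) < 1 / (n + 1) := fun n => Nat.one_div_pos_of_nat
  have hle : ∀ n : ℕ, (1 : ℝ) / (n + 1) ≤ 1 := fun n => by
    rw [div_le_one (by positivity)]
    linarith [(n.cast_nonneg : (0 : ℝ) ≤ n)]
  have hlim := tendsto_one_div_add_atTop_nhds_zero_nat (𝕜 := ℝ)
  -- The truncations to `[c - 1/(n+1), c + 1/(n+1)]` tend to the constant `c`, while their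
  -- derivatives tend to the indicator of the single point `c`. So the constant `c` has `1_{u = c}
  -- Z` as a gradient.
  have hS : StableComp (fun _ => c) (({c} : Set ℝ).indicator fun _ => 1)
      (G : Set (Lp ℝ 2 m × Lp V 2 m)) := by
    refine StableComp.of_tendsto
      (φ := fun n t => max (c - 1 / (n + 1)) (min t (c + 1 / (n + 1))))
      (φ' := fun n => (Set.Ioo (c - 1 / ((n : ℝ) + 1)) (c + 1 / (n + 1))).indicator fun _ => 1)
      (C := 1) (D := |c| + 1) h.closed
      (fun n => h.stableComp_trunc (by linarith [hpos n])) (fun n t => ?_) (fun n t => ?_)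
      (fun t => ?_) (fun t => ?_)
    · rw [abs_le]
      have := hpos n
      have := hle n
      have := neg_abs_le c
      have := le_abs_self c
      have := abs_nonneg t
      constructor
      · exact le_trans (by linarith) (le_max_left _ _)
      · exact max_le (by linarith) ((min_le_right _ _).trans (by linarith))
    · simp only [Set.indicator]
      split_ifs <;> simp
    · have h1 : Tendsto (fun n : ℕ => c - 1 / ((n : ℝ) + 1)) atTop (𝓝 c) := by
        simpa using hlim.const_sub c
      have h2 : Tendsto (fun n : ℕ => c + 1 / ((n : ℝ) + 1)) atTop (𝓝 c) := by
        simpa using hlim.const_add c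
      have h3 := h1.max ((tendsto_const_nhds (x := t)).min h2)
      rwa [max_eq_left (min_le_right _ _)] at h3
    · by_cases ht : t = c
      · subst ht
        refine tendsto_const_nhds.congr fun n => ?_
        have := hpos n
        rw [Set.indicator_of_mem (by simp), Set.indicator_of_mem]
        constructor <;> linarith
      · rw [Set.indicator_of_notMem (by simpa using ht)]
        refine tendsto_const_nhds.congr' ?_
        have h0 : 0 < |t - c| := abs_pos.2 (sub_ne_zero.2 ht)
        filter_upwards [hlim.eventually_lt_const h0] with n hn
        rw [Set.indicator_of_notMem]
        intro hmem
        have : |t - c| < 1 / ((n : ℝ) + 1) := abs_lt.2 ⟨by linarith [hmem.1], by linarith [hmem.2]⟩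
        exact absurd this (not_lt.2 hn.le)
  obtain ⟨q, hqG, hq1, hq2⟩ := hS _ hu
  -- The ordinary chain rule for a constant function gives the same constant the gradient `0`;
  -- uniqueness then forces `1_{u = c} Z = 0`.
  obtain ⟨r, hrG, hr1, hr2⟩ := h.comp (fun _ => c) contDiff_const ⟨0, by simp⟩ _ hu
  have hqr : q.1 = r.1 := by
    refine Lp.ext ?_
    filter_upwards [hq1, hr1] with x e1 e2
    rw [e1, e2]
  have hq : (q.1, q.2) ∈ G := hqG
  have hr : (q.1, r.2) ∈ G := by rw [hqr]; exact hrG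
  have heq := h.unique hq hr
  rw [← heq] at hr2
  filter_upwards [hq2, hr2] with x e1 e2 hx
  rw [e1] at e2
  simpa [hx] using e2

/-- Off the support of `u` one has `u = 0`, hence `Z = 0`; on it `v = c`, hence `Y = 0`. The
integrand `⟨Z, Y⟩` therefore vanishes almost everywhere. The Lindelöf property ensures that the
complement of a support is a null set. -/
theorem isStronglyLocal [IsFiniteMeasure m] [TopologicalSpace X] [OpensMeasurableSpace X]
    [HereditarilyLindelofSpace X] (h : E.IsGradientForm G) : E.IsStronglyLocal := by
  rintro u hu v hv - - ⟨U, -, hU, c, hc⟩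
  obtain ⟨Z, hZ⟩ := (h.mem_dom u).1 hu
  obtain ⟨Y, hY⟩ := (h.mem_dom v).1 hv
  rw [h.val_eq hZ hY, L2.inner_def]
  refine integral_eq_zero_of_ae ?_
  have hs : ∀ᵐ x ∂m, x ∉ supp u → u x = 0 := by
    have h0 : (m.withDensity fun x => ‖u x‖ₑ) (supp u)ᶜ = 0 := Measure.measure_compl_support
    have hmeas : MeasurableSet (supp u)ᶜ := Measure.isOpen_compl_support.measurableSet
    rw [withDensity_apply _ hmeas,
      lintegral_eq_zero_iff' (Lp.aestronglyMeasurable u).enorm.restrict] at h0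
    filter_upwards [(ae_restrict_iff' hmeas).1 h0] with x hx hxs
    simpa using hx hxs
  filter_upwards [hs, hc, h.grad_eq_zero_of_level hZ 0, h.grad_eq_zero_of_level hY c]
    with x h1 h2 h3 h4
  by_cases hx : x ∈ supp u
  · simp [h4 (h2 (hU hx))]
  · simp [h3 (h1 hx)]

end IsGradientForm

/-! ### The Leibniz rule and the energy measures of gradient forms -/

theorem exists_contDiff_eq_sq (M : ℝ) : ∃ φ : ℝ → ℝ, ContDiff ℝ 2 φ ∧
    (∃ C, ∀ t, |deriv φ t| ≤ C) ∧ ∀ t, |t| ≤ M → φ t = t ^ 2 ∧ deriv φ t = 2 * t := by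
  -- The bump equals `1` on a ball of radius larger than `M`, so every `t` with `|t| ≤ M` is
  -- interior to it and the derivatives agree too. Outside a compact set the function is `0`, which
  -- bounds its derivative.
  let b : ContDiffBump (0 : ℝ) := ⟨|M| + 1, |M| + 2, by positivity, by linarith⟩
  have hφ : ContDiff ℝ 2 fun t => t ^ 2 * b t := (contDiff_id.pow 2).mul b.contDiff
  refine ⟨_, hφ, ?_, fun t ht => ?_⟩
  · have hs : HasCompactSupport (deriv fun t => t ^ 2 * b t) :=
      (b.hasCompactSupport.mul_left).deriv
    obtain ⟨C, hC⟩ := hs.exists_bound_of_continuous (hφ.continuous_deriv (by norm_num))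
    exact ⟨C, hC⟩
  · have hev : (fun t => t ^ 2 * b t) =ᶠ[𝓝 t] fun t => t ^ 2 := by
      have hopen : Metric.ball (0 : ℝ) (|M| + 1) ∈ 𝓝 t := by
        refine Metric.isOpen_ball.mem_nhds ?_
        rw [mem_ball_zero_iff, Real.norm_eq_abs]
        linarith [le_abs_self M]
      filter_upwards [hopen] with s hs
      rw [b.one_of_mem_closedBall (Metric.ball_subset_closedBall hs), mul_one]
    refine ⟨hev.eq_of_nhds, ?_⟩
    rw [hev.deriv_eq]
    simp

/-- The measure `|∇u|² dm`. -/
def gradMeasure {W : Type*} [NormedAddCommGroup W] (Z : Lp W 2 m) : Measure X := m.withDensity fun x => ENNReal.ofReal (‖Z x‖ ^ 2)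

theorem integrable_norm_sq {W : Type*} [NormedAddCommGroup W] (Z : Lp W 2 m) : Integrable (fun x => ‖Z x‖ ^ 2) m :=
  (Lp.memLp Z).norm.integrable_sq

instance {W : Type*} [NormedAddCommGroup W] (Z : Lp W 2 m) :
    IsFiniteMeasure (gradMeasure Z) :=
  isFiniteMeasure_withDensity_ofReal (integrable_norm_sq Z).2

theorem gradMeasure_real {W : Type*} [NormedAddCommGroup W] (Z : Lp W 2 m) {A : Set X} (hA : MeasurableSet A) :
    (gradMeasure Z).real A = ∫ x in A, ‖Z x‖ ^ 2 ∂m := by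
  rw [measureReal_def, gradMeasure, withDensity_apply _ hA,
    integral_eq_lintegral_of_nonneg_ae (Eventually.of_forall fun x => by positivity)
      (integrable_norm_sq Z).1.restrict]

theorem integral_gradMeasure {W : Type*} [NormedAddCommGroup W] (Z : Lp W 2 m) (φ : X → ℝ) :
    ∫ x, φ x ∂(gradMeasure Z) = ∫ x, ‖Z x‖ ^ 2 * φ x ∂m := by
  rw [gradMeasure, integral_withDensity_eq_integral_toReal_smul₀
    (integrable_norm_sq Z).1.aemeasurable.ennreal_ofReal (by simp)]
  refine integral_congr_ae (Eventually.of_forall fun x => ?_)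
  simp only [smul_eq_mul]
  rw [ENNReal.toReal_ofReal (by positivity)]

namespace IsGradientForm

variable {E : PartialForm (Lp ℝ 2 m)} {G : Submodule ℝ (Lp ℝ 2 m × Lp V 2 m)}

theorem sq_mem (h : E.IsGradientForm G) {u : Lp ℝ 2 m} {Z : Lp V 2 m} (hu : (u, Z) ∈ G)
    {M : ℝ} (hM : ∀ᵐ x ∂m, |u x| ≤ M) :
    ∃ q ∈ G, (∀ᵐ x ∂m, q.1 x = u x ^ 2) ∧ ∀ᵐ x ∂m, q.2 x = (2 * u x) • Z x := by
  obtain ⟨φ, hφ, hC, hsq⟩ := exists_contDiff_eq_sq M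
  obtain ⟨q, hq, h1, h2⟩ := h.comp φ hφ hC _ hu
  refine ⟨q, hq, ?_, ?_⟩
  · filter_upwards [h1, hM] with x e1 e2
    rw [e1, (hsq _ e2).1]
  · filter_upwards [h2, hM] with x e1 e2
    rw [e1, (hsq _ e2).2]

/-- Leibniz rule by polarization, `uv = ((u + v)² - u² - v²) / 2`; the common bound `M` makes `M +
M` a bound for `u + v`. -/
theorem mul_mem (h : E.IsGradientForm G) {u v : Lp ℝ 2 m} {Z Y : Lp V 2 m} (hu : (u, Z) ∈ G)
    (hv : (v, Y) ∈ G) {M : ℝ} (hM : ∀ᵐ x ∂m, |u x| ≤ M) (hM' : ∀ᵐ x ∂m, |v x| ≤ M) :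
    ∃ q ∈ G, (∀ᵐ x ∂m, q.1 x = u x * v x) ∧ ∀ᵐ x ∂m, q.2 x = u x • Y x + v x • Z x := by
  obtain ⟨p, hp, p1, p2⟩ := h.sq_mem (u := u + v) (Z := Z + Y) (G.add_mem hu hv) (M := M + M) (by
    filter_upwards [hM, hM', Lp.coeFn_add u v] with x e1 e2 e3
    rw [e3]
    exact (abs_add_le _ _).trans (add_le_add e1 e2))
  obtain ⟨r, hr, r1, r2⟩ := h.sq_mem hu hM
  obtain ⟨s, hs, s1, s2⟩ := h.sq_mem hv hM'
  refine ⟨(1 / 2 : ℝ) • (p - r - s), G.smul_mem _ (G.sub_mem (G.sub_mem hp hr) hs), ?_, ?_⟩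
  · filter_upwards [p1, r1, s1, Lp.coeFn_add u v, Lp.coeFn_smul (1 / 2 : ℝ) (p.1 - r.1 - s.1),
      Lp.coeFn_sub (p.1 - r.1) s.1, Lp.coeFn_sub p.1 r.1] with x e1 e2 e3 e4 e5 e6 e7
    change ((1 / 2 : ℝ) • (p.1 - r.1 - s.1) : Lp ℝ 2 m) x = _
    rw [e5, Pi.smul_apply, e6, Pi.sub_apply, e7, Pi.sub_apply, e1, e2, e3, e4, Pi.add_apply,
      smul_eq_mul]
    ring
  · filter_upwards [p2, r2, s2, Lp.coeFn_add u v, Lp.coeFn_smul (1 / 2 : ℝ) (p.2 - r.2 - s.2),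
      Lp.coeFn_sub (p.2 - r.2) s.2, Lp.coeFn_sub p.2 r.2, Lp.coeFn_add Z Y]
      with x e1 e2 e3 e4 e5 e6 e7 e8
    change ((1 / 2 : ℝ) • (p.2 - r.2 - s.2) : Lp V 2 m) x = _
    rw [e5, Pi.smul_apply, e6, Pi.sub_apply, e7, Pi.sub_apply, e1, e2, e3, e4, Pi.add_apply,
      e8, Pi.add_apply]
    module

/-- With `Y` the gradient of `φ`, the expression `E(uφ, u) - E(u², φ)/2` is the integral of `u⟨Y, Z⟩
+ φ‖Z‖² - u⟨Z, Y⟩ = φ‖Z‖²`. -/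
theorem isBoundedEnergyMeasure [TopologicalSpace X] (h : E.IsGradientForm G) {u : Lp ℝ 2 m}
    {Z : Lp V 2 m} (hu : (u, Z) ∈ G) {M : ℝ} (hM : ∀ᵐ x ∂m, |u x| ≤ M) :
    E.IsBoundedEnergyMeasure u (gradMeasure Z) := by
  refine ⟨inferInstance, ?_⟩
  rintro w φ ⟨hw, hφc, hφs, hwφ⟩
  obtain ⟨Y, hY⟩ := (h.mem_dom w).1 hw
  obtain ⟨C, hC⟩ := hφs.exists_bound_of_continuous hφc
  have hwb : ∀ᵐ x ∂m, |w x| ≤ max M C := by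
    filter_upwards [hwφ] with x hx
    rw [hx]
    exact (hC x).trans (le_max_right _ _)
  have hub : ∀ᵐ x ∂m, |u x| ≤ max M C := hM.mono fun x hx => hx.trans (le_max_left _ _)
  obtain ⟨p, hp, p1, p2⟩ := h.mul_mem hu hY hub hwb
  obtain ⟨q, hq, q1, q2⟩ := h.sq_mem hu hM
  refine ⟨p.1, (h.mem_dom _).2 ⟨p.2, hp⟩, q.1, (h.mem_dom _).2 ⟨q.2, hq⟩, ?_, q1, ?_⟩
  · filter_upwards [p1, hwφ] with x e1 e2
    rw [e1, e2]
  · rw [h.val_eq hp hu, h.val_eq hq hY, L2.inner_def, L2.inner_def, integral_gradMeasure,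
      ← integral_div, ← integral_sub (L2.integrable_inner _ _)
        ((L2.integrable_inner _ _).div_const _)]
    refine integral_congr_ae ?_
    filter_upwards [p2, q2, hwφ] with x e1 e2 e3
    rw [e1, e2, inner_add_left, real_inner_smul_left, real_inner_smul_left, real_inner_smul_left,
      real_inner_self_eq_norm_sq, e3, real_inner_comm]
    ring

/-- The truncation at level `n` has gradient `1_{(-n,n)}(u) Z`, which equals `Z` at every point
where `n > |u|` and is dominated by `Z`. Hence the measures converge on every measurable set. -/
theorem isEnergyMeasure [IsFiniteMeasure m] [TopologicalSpace X] (h : E.IsGradientForm G)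
    {u : Lp ℝ 2 m} {Z : Lp V 2 m} (hu : (u, Z) ∈ G) : E.IsEnergyMeasure u (gradMeasure Z) := by
  choose q hq q1 q2 using fun n : ℕ => h.stableComp_trunc
    (neg_le_self (n.cast_nonneg : (0 : ℝ) ≤ n)) (u, Z) hu
  refine ⟨inferInstance, fun n => (q n).1, fun n => gradMeasure (q n).2, fun n => ⟨?_, q1 n, ?_⟩,
    fun A hA => ?_⟩
  · exact (h.mem_dom _).2 ⟨(q n).2, hq n⟩
  · refine h.isBoundedEnergyMeasure (hq n) (M := n) ?_
    filter_upwards [q1 n] with x hx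
    have hn : (0 : ℝ) ≤ n := n.cast_nonneg
    rw [hx, abs_le]
    exact ⟨le_max_left _ _, max_le (by linarith) (min_le_right _ _)⟩
  · simp only [gradMeasure, withDensity_apply _ hA]
    refine tendsto_lintegral_of_dominated_convergence' (fun x => ENNReal.ofReal (‖Z x‖ ^ 2))
      (fun n => (integrable_norm_sq _).1.restrict.aemeasurable.ennreal_ofReal) (fun n => ?_) ?_ ?_
    · filter_upwards [ae_restrict_of_ae (q2 n)] with x hx
      rw [hx, norm_smul]
      refine ENNReal.ofReal_le_ofReal ?_
      gcongr
      refine mul_le_of_le_one_left (norm_nonneg _) ?_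
      simp only [Set.indicator]
      split_ifs <;> simp
    · have := measure_ne_top (gradMeasure Z) A
      rwa [gradMeasure, withDensity_apply _ hA] at this
    · refine ae_restrict_of_ae ?_
      filter_upwards [ae_all_iff.2 q2] with x hx
      refine tendsto_const_nhds.congr' ?_
      filter_upwards [tendsto_natCast_atTop_atTop.eventually_gt_atTop |u x|] with n hn
      rw [hx, Set.indicator_of_mem (Set.mem_Ioo.2 (abs_lt.1 hn)), one_smul]

/-- Polarization: `‖Z + Y‖² - ‖Z‖² - ‖Y‖² = 2⟨Z, Y⟩`. -/
theorem isMutualEnergyMeasure [IsFiniteMeasure m] [TopologicalSpace X] (h : E.IsGradientForm G)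
    {u v : Lp ℝ 2 m} {Z Y : Lp V 2 m} (hu : (u, Z) ∈ G) (hv : (v, Y) ∈ G) :
    E.IsMutualEnergyMeasure u v (m.withDensityᵥ fun x => inner ℝ (Z x) (Y x)) := by
  refine ⟨gradMeasure (Z + Y), gradMeasure Z, gradMeasure Y, inferInstance, inferInstance,
    inferInstance, h.isEnergyMeasure (G.add_mem hu hv), h.isEnergyMeasure hu,
    h.isEnergyMeasure hv, ?_⟩
  ext A hA
  rw [withDensityᵥ_apply (L2.integrable_inner Z Y) hA, smul_apply,
    sub_apply, sub_apply,
    Measure.toSignedMeasure_apply_measurable hA, Measure.toSignedMeasure_apply_measurable hA,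
    Measure.toSignedMeasure_apply_measurable hA, gradMeasure_real _ hA, gradMeasure_real _ hA,
    gradMeasure_real _ hA, ← integral_sub (integrable_norm_sq _).restrict
      (integrable_norm_sq _).restrict, ← integral_sub (f := fun x => _ - _) ((integrable_norm_sq _).restrict.sub
      (integrable_norm_sq _).restrict) (integrable_norm_sq _).restrict, smul_eq_mul,
    ← integral_const_mul]
  refine integral_congr_ae (ae_restrict_of_ae ?_)
  filter_upwards [Lp.coeFn_add Z Y] with x hx
  rw [hx, Pi.add_apply, norm_add_sq_real]
  ring

end IsGradientForm

end PartialForm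

namespace UnitBall

variable {d : ℕ}

/-! ### The divergence of a vector field -/

/-- The divergence of a vector field. -/
def divergence (Y : Space d → Space d) (x : Space d) : ℝ :=
  ∑ i, fderiv ℝ (fun y => Y y i) x (EuclideanSpace.single i 1)

theorem sum_coord_mul {F : Type*} [NormedAddCommGroup F] [NormedSpace ℝ F]
    (L : Space d →L[ℝ] F) (v : Space d) :
    ∑ i, v i • L (EuclideanSpace.single i 1) = L v := by
  have h := (EuclideanSpace.basisFun (Fin d) ℝ).sum_repr v
  conv_rhs => rw [← h]
  simp

theorem differentiableAt_coord {Y : Space d → Space d} {x : Space d}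
    (hY : DifferentiableAt ℝ Y x) (i : Fin d) : DifferentiableAt ℝ (fun y => Y y i) x :=
  ((EuclideanSpace.proj (𝕜 := ℝ) i).differentiableAt).comp x hY

theorem divergence_smul {a : Space d → ℝ} {a' : Space d →L[ℝ] ℝ} {Y : Space d → Space d}
    {x : Space d} (ha : HasFDerivAt a a' x) (hY : DifferentiableAt ℝ Y x) :
    divergence (fun y => a y • Y y) x = a x * divergence Y x + a' (Y x) := by
  rw [divergence, divergence, Finset.mul_sum, ← sum_coord_mul a' (Y x), ← Finset.sum_add_distrib]
  refine Finset.sum_congr rfl fun i _ => ?_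
  have h : fderiv ℝ (fun y => a y * Y y i) x = _ :=
    (ha.mul (differentiableAt_coord hY i).hasFDerivAt).fderiv
  change fderiv ℝ (fun y => a y * Y y i) x _ = _
  rw [h]
  simp

theorem divergence_sub {Y R : Space d → Space d} {x : Space d}
    (hY : DifferentiableAt ℝ Y x) (hR : DifferentiableAt ℝ R x) :
    divergence (fun y => Y y - R y) x = divergence Y x - divergence R x := by
  rw [divergence, divergence, divergence, ← Finset.sum_sub_distrib]
  refine Finset.sum_congr rfl fun i _ => ?_
  change fderiv ℝ (fun y => Y y i - R y i) x _ = _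
  rw [fderiv_fun_sub (differentiableAt_coord hY i) (differentiableAt_coord hR i)]
  rfl

theorem divergence_id (x : Space d) : divergence (fun y => y) x = d := by
  rw [divergence]
  have : ∀ i : Fin d, fderiv ℝ (fun y : Space d => y i) x (EuclideanSpace.single i 1) = 1 := by
    intro i
    have h := (EuclideanSpace.proj (𝕜 := ℝ) i : Space d →L[ℝ] ℝ).hasFDerivAt (x := x)
    change fderiv ℝ (EuclideanSpace.proj (𝕜 := ℝ) i : Space d →L[ℝ] ℝ) x _ = _
    rw [h.fderiv]
    simp
  simp [this]

theorem divergence_const (e x : Space d) : divergence (fun _ => e) x = 0 := by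
  simp [divergence]

theorem divergence_congr {Y R : Space d → Space d} {x : Space d} (h : Y =ᶠ[𝓝 x] R) :
    divergence Y x = divergence R x := by
  refine Finset.sum_congr rfl fun i _ => ?_
  have : (fun y => Y y i) =ᶠ[𝓝 x] fun y => R y i := h.mono fun y hy => by simp [hy]
  rw [this.fderiv_eq]

theorem divergence_eq_zero_of_notMem_tsupport {Y : Space d → Space d} {x : Space d}
    (hx : x ∉ tsupport Y) : divergence Y x = 0 := by
  rw [divergence_congr (notMem_tsupport_iff_eventuallyEq.1 hx)]
  exact divergence_const 0 x

/-- The integral of the divergence of a compactly supported vector field vanishes. -/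
theorem integral_divergence_eq_zero {Y : Space d → Space d} (hY : ContDiff ℝ 1 Y)
    (hc : HasCompactSupport Y) : ∫ x, divergence Y x = 0 := by
  have hd : ∀ i, ContDiff ℝ 1 fun y => Y y i := fun i =>
    (EuclideanSpace.proj (𝕜 := ℝ) i).contDiff.comp hY
  have hs : ∀ i, HasCompactSupport fun y => Y y i := fun i =>
    hc.comp_left (g := fun v : Space d => v i) rfl
  have hint : ∀ i, Integrable fun x => fderiv ℝ (fun y => Y y i) x (EuclideanSpace.single i 1) := by
    intro i
    refine Continuous.integrable_of_hasCompactSupport ?_ ?_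
    · exact ((hd i).continuous_fderiv (by norm_num)).clm_apply continuous_const
    · exact ((hs i).fderiv ℝ).comp_left (g := fun L : Space d →L[ℝ] ℝ =>
        L (EuclideanSpace.single i 1)) rfl
  unfold divergence
  rw [integral_finsetSum _ fun i _ => hint i]
  refine Finset.sum_eq_zero fun i _ => ?_
  -- Integration by parts of each component against the constant function `1`.
  have h := integral_mul_fderiv_eq_neg_fderiv_mul_of_integrable (μ := (volume : Measure (Space d)))
    (f := fun _ => (1 : ℝ)) (g := fun y => Y y i) (v := EuclideanSpace.single i 1)
    (by simp) (by simpa using hint i)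
    (by simpa using (hd i).continuous.integrable_of_hasCompactSupport (hs i))
    (fun _ _ => by fun_prop) (fun x _ => (hd i).differentiable (by norm_num) x)
  simpa using h

theorem contDiff_of_contDiffOn_tsupport {F : Type*} [NormedAddCommGroup F] [NormedSpace ℝ F]
    {Y : Space d → F} {O : Set (Space d)} (hO : IsOpen O) (hY : ContDiffOn ℝ 1 Y O)
    (hsub : tsupport Y ⊆ O) : ContDiff ℝ 1 Y := by
  refine contDiff_iff_contDiffAt.2 fun x => ?_
  by_cases hx : x ∈ tsupport Y
  · exact hY.contDiffAt (hO.mem_nhds (hsub hx))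
  · exact contDiffAt_const.congr_of_eventuallyEq (notMem_tsupport_iff_eventuallyEq.1 hx)

theorem integral_lebesgue {F : Type*} [NormedAddCommGroup F] [NormedSpace ℝ F]
    (h : Space d → F) : ∫ x, h x ∂(lebesgue d) = ∫ x in ballSet d, h x :=
  integral_subtype_comap Metric.isClosed_closedBall.measurableSet h

/-- A field supported inside `O` is globally `C¹` after extension by zero, so smoothness is needed
only on `O`. This admits fields built from the weight or from `|x|⁻¹`. -/
theorem integral_lebesgue_divergence_eq_zero {Y : Space d → Space d} {O : Set (Space d)}
    (hO : IsOpen O) (hOB : O ⊆ ballSet d) (hY : ContDiffOn ℝ 1 Y O) (hc : HasCompactSupport Y)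
    (hsub : tsupport Y ⊆ O) : ∫ x, divergence Y x ∂(lebesgue d) = 0 := by
  rw [integral_lebesgue (divergence Y), setIntegral_eq_integral_of_forall_compl_eq_zero]
  · exact integral_divergence_eq_zero (contDiff_of_contDiffOn_tsupport hO hY hsub) hc
  · intro x hx
    exact divergence_eq_zero_of_notMem_tsupport fun h => hx (hOB (hsub h))

/-! ### The weight -/

/-- The density `(1 - |x|²)^{μ - 1/2}`. -/
def weight (μ : ℝ) (x : Space d) : ℝ := (1 - ‖x‖ ^ 2) ^ (μ - 1 / 2)

theorem one_sub_normSq_nonneg (x : Ball d) : 0 ≤ 1 - ‖(x : Space d)‖ ^ 2 := by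
  have := mem_closedBall_zero_iff.1 x.2
  have := norm_nonneg (x : Space d)
  nlinarith

theorem one_sub_normSq_pos {x : Space d} (hx : x ∈ Metric.ball (0 : Space d) 1) :
    0 < 1 - ‖x‖ ^ 2 := by
  have := mem_ball_zero_iff.1 hx
  have := norm_nonneg x
  nlinarith

theorem weight_pos (μ : ℝ) {x : Space d} (hx : x ∈ Metric.ball (0 : Space d) 1) :
    0 < weight μ x := Real.rpow_pos_of_pos (one_sub_normSq_pos hx) _

theorem measurable_weight (μ : ℝ) : Measurable (weight μ : Space d → ℝ) := by
  unfold weight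
  fun_prop

theorem integral_weightMeasure {F : Type*} [NormedAddCommGroup F] [NormedSpace ℝ F] (μ : ℝ)
    (h : Ball d → F) :
    ∫ x, h x ∂(weightMeasure d μ) = ∫ x, weight μ (x : Space d) • h x ∂(lebesgue d) := by
  rw [weightMeasure, integral_withDensity_eq_integral_toReal_smul]
  · refine integral_congr_ae (Eventually.of_forall fun x => ?_)
    simp only
    rw [ENNReal.toReal_ofReal (Real.rpow_nonneg (one_sub_normSq_nonneg x) _)]
    rfl
  · exact ((measurable_weight μ).comp measurable_subtype_coe).ennreal_ofReal
  · simp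

/-- Almost every point of the ball is an interior point other than `0`. -/
theorem ae_lebesgue_mem (hd : 2 ≤ d) :
    ∀ᵐ x : Ball d ∂(lebesgue d), (x : Space d) ∈ Metric.ball (0 : Space d) 1 \ {0} := by
  have : Nonempty (Fin d) := ⟨⟨0, by omega⟩⟩
  have hnull : volume ((Metric.sphere (0 : Space d) 1) ∪ {0}) = 0 := by
    rw [measure_union_null_iff]
    exact ⟨Measure.addHaar_sphere _ _ _, by simp⟩
  have hemb := MeasurableEmbedding.subtype_coe
    (Metric.isClosed_closedBall (x := (0 : Space d)) (ε := 1)).measurableSet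
  have h1 : lebesgue d (Subtype.val ⁻¹' ((Metric.sphere (0 : Space d) 1) ∪ {0})) = 0 := by
    rw [lebesgue, hemb.comap_apply]
    exact measure_mono_null (Set.image_preimage_subset _ _) hnull
  filter_upwards [measure_eq_zero_iff_ae_notMem.1 h1] with x hx
  simp only [Set.mem_preimage, Set.mem_union, mem_sphere_zero_iff_norm, not_or] at hx
  exact ⟨mem_ball_zero_iff.2 (lt_of_le_of_ne (mem_closedBall_zero_iff.1 x.2) hx.1), hx.2⟩

theorem weightMeasure_absolutelyContinuous (μ : ℝ) : weightMeasure d μ ≪ lebesgue d :=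
  withDensity_absolutelyContinuous _ _

/-- The weight is positive in the open ball. Together with the converse this makes the null sets of
`W_μ` and of Lebesgue measure the same, so weak derivatives and `L²(B, W_μ)` classes can be compared
freely. -/
theorem lebesgue_absolutelyContinuous (hd : 2 ≤ d) (μ : ℝ) : lebesgue d ≪ weightMeasure d μ := by
  refine withDensity_absolutelyContinuous'
    (((measurable_weight μ).comp measurable_subtype_coe).ennreal_ofReal.aemeasurable) ?_
  filter_upwards [ae_lebesgue_mem hd] with x hx
  rw [ne_eq, ENNReal.ofReal_eq_zero, not_le]
  exact weight_pos μ hx.1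

theorem ae_weightMeasure_mem (hd : 2 ≤ d) (μ : ℝ) :
    ∀ᵐ x : Ball d ∂(weightMeasure d μ), (x : Space d) ∈ Metric.ball (0 : Space d) 1 \ {0} :=
  (weightMeasure_absolutelyContinuous μ).ae_le (ae_lebesgue_mem hd)

/-- Factor `(1 - r²)^p = (1 - r)^p (1 + r)^p`: the first factor is integrable for `p > -1`, the
second is continuous on `[0, 1]`. -/
theorem integrableOn_one_sub_sq_rpow {p : ℝ} (hp : -1 < p) :
    IntegrableOn (fun r : ℝ => (1 - r ^ 2) ^ p) (Set.Ioo 0 1) volume := by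
  have h1 : IntervalIntegrable (fun r : ℝ => (1 - r) ^ p) volume 0 1 := by
    have := (intervalIntegral.intervalIntegrable_rpow' (a := 1) (b := 0) hp).comp_sub_left 1
    simpa using this
  have h2 : IntervalIntegrable (fun r : ℝ => (1 - r) ^ p * (1 + r) ^ p) volume 0 1 := by
    refine h1.mul_continuousOn ?_
    refine ContinuousOn.rpow_const (by fun_prop) fun r hr => Or.inl ?_
    rw [Set.uIcc_of_le zero_le_one] at hr
    linarith [hr.1]
  rw [intervalIntegrable_iff_integrableOn_Ioo_of_le zero_le_one] at h2
  refine h2.congr_fun (fun r hr => ?_) measurableSet_Ioo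
  simp only
  rw [← Real.mul_rpow (by linarith [hr.2]) (by linarith [hr.1])]
  ring_nf

/-- Polar coordinates reduce this to `r^{d-1} (1 - r²)^{μ-1/2}` on `(0, 1)`, where the power of `r`
is at most `1`. The condition `μ > -1/2` is the one that makes the exponent exceed `-1`. -/
theorem isFiniteMeasure_weightMeasure (hd : 2 ≤ d) {μ : ℝ} (hμ : -(1 / 2) < μ) :
    IsFiniteMeasure (weightMeasure d μ) := by
  have : Nonempty (Fin d) := ⟨⟨0, by omega⟩⟩
  have h0 : IntegrableOn (weight μ) (Metric.ball (0 : Space d) 1) volume := by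
    have := (integrableOn_fun_norm_addHaar (volume : Measure (Space d))
      (f := fun r => (1 - r ^ 2) ^ (μ - 1 / 2)) (r := 1)).2 ?_
    · exact this
    · have h1 := integrableOn_one_sub_sq_rpow (p := μ - 1 / 2) (by linarith)
      refine Integrable.mono h1 (by fun_prop) ?_
      refine (ae_restrict_iff' measurableSet_Ioo).2 (Eventually.of_forall fun r hr => ?_)
      rw [norm_smul]
      refine mul_le_of_le_one_left (norm_nonneg _) ?_
      rw [norm_pow, Real.norm_of_nonneg hr.1.le]
      exact pow_le_one₀ hr.1.le hr.2.le
  have hball : Metric.ball (0 : Space d) 1 =ᵐ[volume] ballSet d := by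
    rw [ballSet, ← Metric.ball_union_sphere]
    exact (union_ae_eq_left_of_ae_eq_empty
      (ae_eq_empty.2 (Measure.addHaar_sphere _ _ _))).symm
  have h1 : IntegrableOn (weight μ) (ballSet d) volume := h0.congr_set_ae hball.symm
  refine isFiniteMeasure_withDensity_ofReal (f := fun x : Ball d => weight μ (x : Space d)) ?_
  have hemb := MeasurableEmbedding.subtype_coe
    (Metric.isClosed_closedBall (x := (0 : Space d)) (ε := 1)).measurableSet
  have h2 : Integrable (fun x : Ball d => weight μ (x : Space d)) (lebesgue d) := by
    have h3 := (hemb.integrableOn_iff_comap (by rw [Subtype.range_coe])).1 h1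
    rwa [Subtype.coe_preimage_self, integrableOn_univ] at h3
  exact h2.2

/-! ### Derivatives up to the boundary -/

theorem uniqueDiffOn_ballSet : UniqueDiffOn ℝ (ballSet d) :=
  uniqueDiffOn_convex (convex_closedBall _ _)
    ⟨0, Metric.ball_subset_interior_closedBall (Metric.mem_ball_self one_pos)⟩

theorem ballSet_mem_nhds {x : Space d} (hx : x ∈ Metric.ball (0 : Space d) 1) :
    ballSet d ∈ 𝓝 x :=
  mem_of_superset (Metric.isOpen_ball.mem_nhds hx) Metric.ball_subset_closedBall

/-- The derivative of a function on the ball, one-sided at the boundary. -/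
abbrev ballDeriv (f : Space d → ℝ) (x : Space d) : Space d →L[ℝ] ℝ :=
  fderivWithin ℝ f (ballSet d) x

theorem ballDeriv_eq {f : Space d → ℝ} {x : Space d} (hx : x ∈ Metric.ball (0 : Space d) 1) :
    ballDeriv f x = fderiv ℝ f x := fderivWithin_of_mem_nhds (ballSet_mem_nhds hx)

theorem IsC2.contDiffOn_ballDeriv {f : Space d → ℝ} (hf : IsC2 f) :
    ContDiffOn ℝ 1 (ballDeriv f) (ballSet d) :=
  ContDiffOn.fderivWithin hf uniqueDiffOn_ballSet (by norm_num)

theorem IsC2.contDiffOn_partialDeriv {f : Space d → ℝ} (hf : IsC2 f) (i : Fin d) :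
    ContDiffOn ℝ 1 (partialDeriv i f) (ballSet d) :=
  hf.contDiffOn_ballDeriv.clm_apply contDiffOn_const

theorem IsC2.continuousOn_diffOp {f : Space d → ℝ} (hf : IsC2 f) (μ : ℝ) :
    ContinuousOn (diffOp μ f) (ballSet d) := by
  have h1 : ∀ i, ContinuousOn (partialDeriv i f) (ballSet d) := fun i =>
    (hf.contDiffOn_partialDeriv i).continuousOn
  have h2 : ∀ i j, ContinuousOn (partialDeriv i (partialDeriv j f)) (ballSet d) := fun i j =>
    ((hf.contDiffOn_partialDeriv j).continuousOn_fderivWithin uniqueDiffOn_ballSet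
      le_rfl).clm_apply continuousOn_const
  have h3 : ∀ i, ContinuousOn (fun x : Space d => x i) (ballSet d) := fun i => by fun_prop
  unfold diffOp
  refine ((continuousOn_finsetSum _ fun i _ => h2 i i).neg.add (continuousOn_finsetSum _ fun i _ =>
    continuousOn_finsetSum _ fun j _ => ((h3 i).mul (h3 j)).mul (h2 i j))).add
    (continuousOn_const.mul (continuousOn_finsetSum _ fun i _ => (h3 i).mul (h1 i)))

/-! ### The weighted gradient of a `C²` function -/

/-- The space in which the weighted gradients take their values. -/
abbrev GradSpace (d : ℕ) : Type := WithLp 2 (ℝ × Space d)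

/-- The pair `(√(1 - |x|²) ∂_r f, |x|⁻¹ ∇₀ f)` in terms of the derivative `L` of `f` at `x`. -/
def gradSymbol (x : Space d) (L : Space d →L[ℝ] ℝ) : GradSpace d :=
  WithLp.toLp 2 (√(1 - ‖x‖ ^ 2) * (‖x‖⁻¹ * L x),
    (InnerProductSpace.toDual ℝ (Space d)).symm L - ((‖x‖ ^ 2)⁻¹ * L x) • x)

theorem gradSymbol_add (x : Space d) (L R : Space d →L[ℝ] ℝ) :
    gradSymbol x (L + R) = gradSymbol x L + gradSymbol x R := by
  rw [gradSymbol, gradSymbol, gradSymbol, ← WithLp.toLp_add, Prod.mk_add_mk]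
  congr 2
  · simp only [_root_.add_apply]
    ring
  · simp only [_root_.add_apply, map_add]
    module

theorem gradSymbol_smul (x : Space d) (c : ℝ) (L : Space d →L[ℝ] ℝ) :
    gradSymbol x (c • L) = c • gradSymbol x L := by
  refine congrArg (WithLp.toLp 2) (Prod.ext ?_ ?_)
  · change _ = c • (√(1 - ‖x‖ ^ 2) * (‖x‖⁻¹ * L x))
    simp only [_root_.smul_apply, smul_eq_mul]
    ring
  · change _ = c • ((InnerProductSpace.toDual ℝ (Space d)).symm L - ((‖x‖ ^ 2)⁻¹ * L x) • x)
    simp only [_root_.smul_apply, smul_eq_mul, map_smul]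
    module

/-- The radial slots contribute `(1 - |x|²)|x|⁻² (Lx)(Rx)`, the tangential ones `⟨L, R⟩ - |x|⁻²
(Lx)(Rx)`. The singular terms cancel. At the origin the convention `0⁻¹ = 0` leaves the full
gradient in the second slot, so the formula persists there. -/
theorem inner_gradSymbol {x : Space d} (hx : ‖x‖ ≤ 1) (L R : Space d →L[ℝ] ℝ) :
    inner ℝ (gradSymbol x L) (gradSymbol x R) =
      R ((InnerProductSpace.toDual ℝ (Space d)).symm L) - L x * R x := by
  set a := (InnerProductSpace.toDual ℝ (Space d)).symm L with ha
  set b := (InnerProductSpace.toDual ℝ (Space d)).symm R with hb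
  have h1 : ∀ v, L v = inner ℝ a v := fun v => (InnerProductSpace.toDual_symm_apply).symm
  have h2 : ∀ v, R v = inner ℝ b v := fun v => (InnerProductSpace.toDual_symm_apply).symm
  rw [gradSymbol, gradSymbol, WithLp.prod_inner_apply, ← ha, ← hb]
  simp only [inner_sub_left, inner_sub_right, real_inner_smul_left, real_inner_smul_right,
    RCLike.inner_apply, conj_trivial, real_inner_self_eq_norm_sq]
  rw [show inner ℝ a x = L x from (h1 x).symm, show inner ℝ x b = R x by
    rw [real_inner_comm, h2], show inner ℝ a b = R a by rw [real_inner_comm, h2]]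
  rcases eq_or_ne x 0 with rfl | h0
  · simp
  · have hn : ‖x‖ ≠ 0 := norm_ne_zero_iff.2 h0
    have hs : √(1 - ‖x‖ ^ 2) * √(1 - ‖x‖ ^ 2) = 1 - ‖x‖ ^ 2 :=
      Real.mul_self_sqrt (by nlinarith [norm_nonneg x])
    have e1 : √(1 - ‖x‖ ^ 2) * (‖x‖⁻¹ * R x) * (√(1 - ‖x‖ ^ 2) * (‖x‖⁻¹ * L x)) =
        (1 - ‖x‖ ^ 2) * (‖x‖⁻¹ ^ 2 * (R x * L x)) := by
      linear_combination (‖x‖⁻¹ ^ 2 * (R x * L x)) * hs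
    rw [e1]
    field_simp
    ring

theorem norm_gradSymbol_le {x : Space d} (hx : ‖x‖ ≤ 1) (L : Space d →L[ℝ] ℝ) :
    ‖gradSymbol x L‖ ≤ ‖L‖ := by
  refine le_of_sq_le_sq ?_ (norm_nonneg _)
  rw [← real_inner_self_eq_norm_sq, inner_gradSymbol hx]
  have h1 : L ((InnerProductSpace.toDual ℝ (Space d)).symm L) = ‖L‖ ^ 2 := by
    rw [← InnerProductSpace.toDual_symm_apply (𝕜 := ℝ), real_inner_self_eq_norm_sq,
      LinearIsometryEquiv.norm_map]
  rw [h1]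
  nlinarith [mul_self_nonneg (L x)]

/-- The symbol itself is in general discontinuous at the origin, so only measurability is available;
its norm is controlled by that of `D`. -/
theorem measurable_gradSymbol {D : Ball d → (Space d →L[ℝ] ℝ)} (hD : Continuous D) :
    Measurable fun x : Ball d => gradSymbol (x : Space d) (D x) := by
  have h1 : Measurable fun x : Ball d => D x (x : Space d) :=
    (hD.clm_apply continuous_subtype_val).measurable
  have h2 : Measurable fun x : Ball d => (InnerProductSpace.toDual ℝ (Space d)).symm (D x) :=
    ((LinearIsometryEquiv.continuous _).comp hD).measurable
  have h3 : Measurable fun x : Ball d => (x : Space d) := measurable_subtype_coe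
  unfold gradSymbol
  refine (WithLp.measurable_toLp 2 _).comp (Measurable.prodMk ?_ ?_)
  · exact ((measurable_const.sub (h3.norm.pow_const 2)).sqrt).mul (h3.norm.inv.mul h1)
  · exact h2.sub (((h3.norm.pow_const 2).inv.mul h1).smul h3)

theorem continuous_ball {F : Type*} [TopologicalSpace F] {h : Space d → F}
    (hh : ContinuousOn h (ballSet d)) : Continuous fun x : Ball d => h x :=
  continuousOn_iff_continuous_domRestrict.1 hh

theorem memLp_continuous {F : Type*} [NormedAddCommGroup F] {m : Measure (Ball d)}
    [IsFiniteMeasure m] {h : Ball d → F} (hh : Continuous h) (p : ENNReal) : MemLp h p m :=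
  hh.memLp_of_hasCompactSupport (HasCompactSupport.of_compactSpace _)

theorem integrable_continuous {F : Type*} [NormedAddCommGroup F] {m : Measure (Ball d)}
    [IsFiniteMeasure m] {h : Ball d → F} (hh : Continuous h) : Integrable h m :=
  memLp_one_iff_integrable.1 (memLp_continuous hh 1)

/-- The weighted gradient of a `C²` function. -/
def smoothGrad (f : Space d → ℝ) (x : Ball d) : GradSpace d :=
  gradSymbol (x : Space d) (ballDeriv f x)

theorem IsC2.continuous_ballDeriv {f : Space d → ℝ} (hf : IsC2 f) :
    Continuous fun x : Ball d => ballDeriv f x :=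
  continuous_ball hf.contDiffOn_ballDeriv.continuousOn

theorem IsC2.memLp_smoothGrad {f : Space d → ℝ} (hf : IsC2 f) {m : Measure (Ball d)}
    [IsFiniteMeasure m] : MemLp (smoothGrad f) 2 m := by
  refine (memLp_continuous hf.continuous_ballDeriv 2).of_le
    (measurable_gradSymbol hf.continuous_ballDeriv).aestronglyMeasurable
    (Eventually.of_forall fun x => norm_gradSymbol_le (mem_closedBall_zero_iff.1 x.2) _)

theorem IsC2.memLp {f : Space d → ℝ} (hf : IsC2 f) {m : Measure (Ball d)}
    [IsFiniteMeasure m] : MemLp (fun x : Ball d => f x) 2 m :=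
  memLp_continuous (continuous_ball (ContDiffOn.continuousOn hf)) 2

/-! ### Green's formula -/

/-- With `t = n(1 - |x|²) - 1` the quantity `deriv Real.smoothTransition t * (t + 1)` is the radial
error produced by the `n`-th cut-off function. Its bound does not depend on `n`, and it is zero once
`t > 1`. -/
theorem exists_bound_deriv_smoothTransition :
    (∃ C, ∀ t ≥ -1, |deriv Real.smoothTransition t * (t + 1)| ≤ C) ∧
      ∀ t > 1, deriv Real.smoothTransition t = 0 := by
  have h0 : ∀ t > 1, deriv Real.smoothTransition t = 0 := by
    intro t ht
    have : Real.smoothTransition =ᶠ[𝓝 t] fun _ => 1 := by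
      filter_upwards [lt_mem_nhds ht] with s hs using Real.smoothTransition.one_of_one_le hs.le
    rw [this.deriv_eq, deriv_const]
  have hc : Continuous fun t => deriv Real.smoothTransition t * (t + 1) :=
    ((Real.smoothTransition.contDiff (n := 1)).continuous_deriv (by norm_num)).mul (by fun_prop)
  obtain ⟨C, hC⟩ := (isCompact_Icc (a := (-1 : ℝ)) (b := 1)).exists_bound_of_continuousOn
    hc.continuousOn
  refine ⟨⟨C, fun t ht => ?_⟩, h0⟩
  rcases le_or_gt t 1 with h | h
  · exact hC t ⟨ht, h⟩
  · rw [h0 t h, zero_mul, abs_zero]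
    exact (norm_nonneg _).trans (hC 0 ⟨by norm_num, by norm_num⟩)

/-- The vector field `∇f - (x · ∇f) x`. -/
def greenField (f : Space d → ℝ) (x : Space d) : Space d :=
  (InnerProductSpace.toDual ℝ (Space d)).symm (fderiv ℝ f x) - fderiv ℝ f x x • x

theorem inner_greenField (f : Space d → ℝ) (x : Space d) :
    inner ℝ x (greenField f x) = (1 - ‖x‖ ^ 2) * fderiv ℝ f x x := by
  rw [greenField, inner_sub_right, real_inner_smul_right, real_inner_self_eq_norm_sq,
    real_inner_comm, InnerProductSpace.toDual_symm_apply]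
  ring

theorem IsC2.contDiffOn_fderiv {f : Space d → ℝ} (hf : IsC2 f) :
    ContDiffOn ℝ 1 (fderiv ℝ f) (Metric.ball 0 1) :=
  (ContDiffOn.mono hf Metric.ball_subset_closedBall).fderiv_of_isOpen Metric.isOpen_ball
    (by norm_num)

theorem IsC2.differentiableAt_fderiv {f : Space d → ℝ} (hf : IsC2 f) {x : Space d}
    (hx : x ∈ Metric.ball (0 : Space d) 1) : DifferentiableAt ℝ (fderiv ℝ f) x :=
  (hf.contDiffOn_fderiv.contDiffAt (Metric.isOpen_ball.mem_nhds hx)).differentiableAt (by norm_num)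

theorem IsC2.contDiffOn_greenField {f : Space d → ℝ} (hf : IsC2 f) :
    ContDiffOn ℝ 1 (greenField f) (Metric.ball 0 1) := by
  have h := hf.contDiffOn_fderiv
  exact ((LinearIsometryEquiv.contDiff _).comp_contDiffOn h).sub
    ((h.clm_apply contDiffOn_id).smul contDiffOn_id)

/-- One has `div((x · ∇f) x) = D²f(x, x) + (d + 1)(x · ∇f)`, so the divergence is `Δf - D²f(x, x) -
(d + 1)(x · ∇f)`. This differs from `-L_μ f` only by a first-order term, which the derivative of the
weight will absorb. -/
theorem IsC2.divergence_greenField {f : Space d → ℝ} (hf : IsC2 f) {x : Space d}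
    (hx : x ∈ Metric.ball (0 : Space d) 1) (μ : ℝ) :
    divergence (greenField f) x = (2 * μ - 1) * fderiv ℝ f x x - diffOp μ f x := by
  have hD := hf.differentiableAt_fderiv hx
  set D2 := fderiv ℝ (fderiv ℝ f) x with hD2
  have hp : ∀ i, ∀ y ∈ Metric.ball (0 : Space d) 1,
      partialDeriv i f y = fderiv ℝ f y (EuclideanSpace.single i 1) := fun i y hy => by
    rw [partialDeriv, fderivWithin_of_mem_nhds (ballSet_mem_nhds hy)]
  have hap : ∀ v : Space d, HasFDerivAt (fun y => fderiv ℝ f y v) (D2.flip v) x := fun v => by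
    have := hD.hasFDerivAt.clm_apply (hasFDerivAt_const v x)
    simpa using this
  have hpp : ∀ i j, partialDeriv i (partialDeriv j f) x =
      D2 (EuclideanSpace.single i 1) (EuclideanSpace.single j 1) := fun i j => by
    rw [partialDeriv, fderivWithin_of_mem_nhds (ballSet_mem_nhds hx)]
    have he : partialDeriv j f =ᶠ[𝓝 x] fun y => fderiv ℝ f y (EuclideanSpace.single j 1) := by
      filter_upwards [Metric.isOpen_ball.mem_nhds hx] with y hy using hp j y hy
    rw [he.fderiv_eq, (hap _).fderiv]
    rfl
  have hrad : HasFDerivAt (fun y => fderiv ℝ f y y) (D2.flip x + fderiv ℝ f x) x := by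
    have := hD.hasFDerivAt.clm_apply (hasFDerivAt_id x)
    refine this.congr_fderiv ?_
    ext v
    simp [add_comm, hD2]
  have hg : DifferentiableAt ℝ
      (fun y => (InnerProductSpace.toDual ℝ (Space d)).symm (fderiv ℝ f y)) x :=
    ((LinearIsometryEquiv.differentiable _) _).comp x hD
  have h1 : divergence (greenField f) x =
      divergence (fun y => (InnerProductSpace.toDual ℝ (Space d)).symm (fderiv ℝ f y)) x
        - divergence (fun y => fderiv ℝ f y y • y) x :=
    divergence_sub hg (hrad.differentiableAt.smul differentiableAt_id)
  have h2 : divergence (fun y => (InnerProductSpace.toDual ℝ (Space d)).symm (fderiv ℝ f y)) x =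
      ∑ i, D2 (EuclideanSpace.single i 1) (EuclideanSpace.single i 1) := by
    refine Finset.sum_congr rfl fun i _ => ?_
    have : (fun y => ((InnerProductSpace.toDual ℝ (Space d)).symm (fderiv ℝ f y)) i) =
        fun y => fderiv ℝ f y (EuclideanSpace.single i 1) := by
      funext y
      rw [← InnerProductSpace.toDual_symm_apply (𝕜 := ℝ), real_inner_comm,
        EuclideanSpace.inner_single_left]
      simp
    rw [this, (hap _).fderiv]
    rfl
  have h3 : ∑ i, ∑ j, x i * x j * D2 (EuclideanSpace.single i 1) (EuclideanSpace.single j 1) =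
      D2 x x := by
    have hsum := sum_coord_mul (D2.flip x) x
    rw [ContinuousLinearMap.flip_apply] at hsum
    rw [← hsum]
    refine Finset.sum_congr rfl fun i _ => ?_
    rw [ContinuousLinearMap.flip_apply, ← sum_coord_mul _ x, Finset.smul_sum]
    refine Finset.sum_congr rfl fun j _ => ?_
    simp only [smul_eq_mul]
    ring
  have h4 : ∑ i, x i * fderiv ℝ f x (EuclideanSpace.single i 1) = fderiv ℝ f x x :=
    sum_coord_mul (fderiv ℝ f x) x
  rw [h1, h2, divergence_smul (Y := fun y => y) hrad differentiableAt_fun_id, divergence_id, diffOp]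
  simp only [hpp, hp _ x hx, h3, h4]
  simp only [_root_.add_apply, ContinuousLinearMap.flip_apply]
  ring

theorem hasFDerivAt_one_sub_normSq (x : Space d) :
    HasFDerivAt (fun y : Space d => 1 - ‖y‖ ^ 2) ((-2 : ℝ) • innerSL ℝ x) x := by
  have := (hasStrictFDerivAt_norm_sq x).hasFDerivAt.const_sub 1
  refine this.congr_fderiv ?_
  ext v
  simp

theorem hasFDerivAt_weight (μ : ℝ) {x : Space d} (hx : x ∈ Metric.ball (0 : Space d) 1) :
    HasFDerivAt (weight μ)
      (((μ - 1 / 2) * (1 - ‖x‖ ^ 2) ^ (μ - 1 / 2 - 1)) • ((-2 : ℝ) • innerSL ℝ x)) x :=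
  (hasFDerivAt_one_sub_normSq x).rpow_const (Or.inl (one_sub_normSq_pos hx).ne')

theorem contDiffOn_weight (μ : ℝ) :
    ContDiffOn ℝ 1 (weight μ : Space d → ℝ) (Metric.ball 0 1) :=
  ContDiffOn.rpow_const_of_ne (contDiff_const.sub (contDiff_norm_sq ℝ)).contDiffOn
    fun _ hx => (one_sub_normSq_pos hx).ne'

/-- Cut-off functions that are supported inside the ball. -/
def cutoff (n : ℕ) (x : Space d) : ℝ := Real.smoothTransition (n * (1 - ‖x‖ ^ 2) - 1)

theorem hasFDerivAt_cutoff (n : ℕ) (x : Space d) :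
    HasFDerivAt (cutoff n) (deriv Real.smoothTransition (n * (1 - ‖x‖ ^ 2) - 1) •
      ((n : ℝ) • ((-2 : ℝ) • innerSL ℝ x))) x := by
  have h1 : HasDerivAt Real.smoothTransition (deriv Real.smoothTransition (n * (1 - ‖x‖ ^ 2) - 1))
      (n * (1 - ‖x‖ ^ 2) - 1) :=
    ((Real.smoothTransition.contDiff (n := 1)).differentiable (by norm_num) _).hasDerivAt
  exact h1.comp_hasFDerivAt x (((hasFDerivAt_one_sub_normSq x).const_mul (n : ℝ)).sub_const 1)

theorem contDiff_cutoff (n : ℕ) : ContDiff ℝ 1 (cutoff n : Space d → ℝ) :=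
  Real.smoothTransition.contDiff.comp
    ((contDiff_const.mul (contDiff_const.sub (contDiff_norm_sq ℝ))).sub contDiff_const)

/-- Thanks to the shift by `-1` the cut-off function vanishes where `n(1 - |x|²) < 1`, and the
remaining closed set lies in the open ball. -/
theorem tsupport_cutoff_subset {n : ℕ} {F : Type*} [NormedAddCommGroup F] {Y : Space d → F}
    (hY : ∀ x, cutoff n x = 0 → Y x = 0) :
    HasCompactSupport Y ∧ tsupport Y ⊆ Metric.ball 0 1 := by
  have hcl : IsClosed {x : Space d | (1 : ℝ) ≤ n * (1 - ‖x‖ ^ 2)} :=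
    isClosed_le continuous_const (by fun_prop)
  have hsub : tsupport Y ⊆ {x : Space d | (1 : ℝ) ≤ n * (1 - ‖x‖ ^ 2)} := by
    refine closure_minimal (fun x hx => ?_) hcl
    by_contra h
    refine hx (hY x (Real.smoothTransition.zero_of_nonpos ?_))
    simp only [Set.mem_ofPred_eq, not_le] at h
    linarith
  have hball : {x : Space d | (1 : ℝ) ≤ n * (1 - ‖x‖ ^ 2)} ⊆ Metric.ball 0 1 := by
    intro x hx
    rw [mem_ball_zero_iff]
    by_contra h
    have h1 : 1 - ‖x‖ ^ 2 ≤ 0 := by nlinarith [norm_nonneg x]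
    have h2 := mul_nonpos_of_nonneg_of_nonpos (n.cast_nonneg : (0 : ℝ) ≤ n) h1
    linarith [Set.mem_ofPred_eq ▸ hx]
  refine ⟨?_, hsub.trans hball⟩
  exact (isCompact_closedBall (0 : Space d) 1).of_isClosed_subset (isClosed_tsupport _)
    ((hsub.trans hball).trans Metric.ball_subset_closedBall)

/-- The derivative of the cut-off function along the field `∇f - (x · ∇f) x`. -/
def cutoffDeriv (n : ℕ) (f : Space d → ℝ) (x : Space d) : ℝ :=
  -2 * (deriv Real.smoothTransition (n * (1 - ‖x‖ ^ 2) - 1) *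
    ((n * (1 - ‖x‖ ^ 2) - 1) + 1)) * ballDeriv f x x

/-- Since `x · P = (1 - |x|²)(x · ∇f)`, differentiating the weight along `P` gives `-(2μ - 1) W (x ·
∇f)`, the lost power of `1 - |x|²` being restored. This cancels the first-order term of `div P`. The
derivative of `g` along `P` yields the inner product of the symbols. -/
theorem divergence_cutoff_greenField {f g : Space d → ℝ} (hf : IsC2 f) (hg : IsC2 g) (μ : ℝ)
    (n : ℕ) {x : Space d} (hx : x ∈ Metric.ball (0 : Space d) 1) :
    divergence (fun y => (cutoff n y * g y * weight μ y) • greenField f y) x =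
      weight μ x * (cutoff n x *
        (inner ℝ (gradSymbol x (ballDeriv f x)) (gradSymbol x (ballDeriv g x)) -
          diffOp μ f x * g x) + g x * cutoffDeriv n f x) := by
  have hs := one_sub_normSq_pos hx
  have hgx : HasFDerivAt g (fderiv ℝ g x) x :=
    ((ContDiffOn.contDiffAt hg (ballSet_mem_nhds hx)).differentiableAt (by norm_num)).hasFDerivAt
  have hP : DifferentiableAt ℝ (greenField f) x :=
    (hf.contDiffOn_greenField.contDiffAt (Metric.isOpen_ball.mem_nhds hx)).differentiableAt
      (by norm_num)
  have ha : HasFDerivAt (fun y => cutoff n y * g y * weight μ y) _ x :=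
    ((hasFDerivAt_cutoff n x).mul hgx).mul (hasFDerivAt_weight μ hx)
  rw [divergence_smul ha hP, hf.divergence_greenField hx μ,
    inner_gradSymbol (mem_ball_zero_iff.1 hx).le, cutoffDeriv, ballDeriv_eq hx, ballDeriv_eq hx]
  have hgP : fderiv ℝ g x (greenField f x) =
      fderiv ℝ g x ((InnerProductSpace.toDual ℝ (Space d)).symm (fderiv ℝ f x)) -
        fderiv ℝ f x x * fderiv ℝ g x x := by
    rw [greenField, map_sub, map_smul, smul_eq_mul]
  have hw : (1 - ‖x‖ ^ 2) ^ (μ - 1 / 2 - 1) * (1 - ‖x‖ ^ 2) = weight μ x := by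
    rw [weight, Real.rpow_sub_one hs.ne']
    field_simp
  simp only [_root_.add_apply, _root_.smul_apply, smul_eq_mul, innerSL_apply_apply,
    inner_greenField, hgP, Pi.mul_apply]
  linear_combination (-2 * cutoff n x * g x * (μ - 1 / 2) * fderiv ℝ f x x) * hw

theorem integral_cutoff_eq_zero (hd : 2 ≤ d) {f g : Space d → ℝ} (hf : IsC2 f) (hg : IsC2 g)
    (μ : ℝ) (n : ℕ) :
    ∫ x : Ball d, (cutoff n (x : Space d) *
      (inner ℝ (smoothGrad f x) (smoothGrad g x) - diffOp μ f x * g x) +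
        g x * cutoffDeriv n f x) ∂(weightMeasure d μ) = 0 := by
  obtain ⟨hc, hsub⟩ := tsupport_cutoff_subset (n := n)
    (Y := fun y : Space d => (cutoff n y * g y * weight μ y) • greenField f y)
    (fun x hx => by simp [hx])
  have h1 : ContDiffOn ℝ 1 (fun y : Space d => (cutoff n y * g y * weight μ y) • greenField f y)
      (Metric.ball 0 1) := by
    refine (((contDiff_cutoff n).contDiffOn.mul ?_).mul (contDiffOn_weight μ)).smul
      hf.contDiffOn_greenField
    exact ((ContDiffOn.mono hg Metric.ball_subset_closedBall).of_le (by norm_num))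
  rw [← integral_lebesgue_divergence_eq_zero Metric.isOpen_ball Metric.ball_subset_closedBall h1
    hc hsub, integral_weightMeasure]
  refine integral_congr_ae ?_
  filter_upwards [ae_lebesgue_mem hd] with x hx
  rw [divergence_cutoff_greenField hf hg μ n hx.1]
  rfl

theorem continuous_cutoffDeriv (n : ℕ) {f : Space d → ℝ} (hf : IsC2 f) :
    Continuous fun x : Ball d => cutoffDeriv n f x := by
  have h1 : Continuous (deriv Real.smoothTransition) :=
    (Real.smoothTransition.contDiff (n := 1)).continuous_deriv (by norm_num)
  have h2 : Continuous fun x : Ball d => ballDeriv f x (x : Space d) :=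
    hf.continuous_ballDeriv.clm_apply continuous_subtype_val
  have h3 : Continuous fun x : Ball d => (n : ℝ) * (1 - ‖(x : Space d)‖ ^ 2) - 1 := by fun_prop
  exact (continuous_const.mul ((h1.comp h3).mul (h3.add continuous_const))).mul h2

/-- The weighted gradients may jump at the origin, but their inner product has a formula without
`|x|⁻¹`. -/
theorem continuous_inner_smoothGrad {f g : Space d → ℝ} (hf : IsC2 f) (hg : IsC2 g) :
    Continuous fun x : Ball d => inner ℝ (smoothGrad f x) (smoothGrad g x) := by
  have h : (fun x : Ball d => inner ℝ (smoothGrad f x) (smoothGrad g x)) = fun x : Ball d =>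
      ballDeriv g x ((InnerProductSpace.toDual ℝ (Space d)).symm (ballDeriv f x)) -
        ballDeriv f x (x : Space d) * ballDeriv g x (x : Space d) :=
    funext fun x => inner_gradSymbol (mem_closedBall_zero_iff.1 x.2) _ _
  rw [h]
  exact (hg.continuous_ballDeriv.clm_apply
    ((LinearIsometryEquiv.continuous _).comp hf.continuous_ballDeriv)).sub
    ((hf.continuous_ballDeriv.clm_apply continuous_subtype_val).mul
      (hg.continuous_ballDeriv.clm_apply continuous_subtype_val))

/-- Green's formula. -/
theorem integral_diffOp_mul (hd : 2 ≤ d) {μ : ℝ} (hμ : -(1 / 2) < μ) {f g : Space d → ℝ}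
    (hf : IsC2 f) (hg : IsC2 g) :
    ∫ x : Ball d, diffOp μ f (x : Space d) * g x ∂(weightMeasure d μ) =
      ∫ x, inner ℝ (smoothGrad f x) (smoothGrad g x) ∂(weightMeasure d μ) := by
  have := isFiniteMeasure_weightMeasure hd hμ
  obtain ⟨⟨C, hC⟩, hzero⟩ := exists_bound_deriv_smoothTransition
  have hgc : Continuous fun x : Ball d => g x := continuous_ball (ContDiffOn.continuousOn hg)
  have hLg : Continuous fun x : Ball d => diffOp μ f (x : Space d) * g x :=
    (continuous_ball (hf.continuousOn_diffOp μ)).mul hgc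
  have hin := continuous_inner_smoothGrad hf hg
  have hdf : Continuous fun x : Ball d => ballDeriv f x (x : Space d) :=
    hf.continuous_ballDeriv.clm_apply continuous_subtype_val
  have hlim : Tendsto (fun n : ℕ => ∫ x : Ball d, (cutoff n (x : Space d) *
      (inner ℝ (smoothGrad f x) (smoothGrad g x) - diffOp μ f x * g x) +
        g x * cutoffDeriv n f x) ∂(weightMeasure d μ)) atTop
      (𝓝 (∫ x : Ball d, (inner ℝ (smoothGrad f x) (smoothGrad g x) - diffOp μ f x * g x)
        ∂(weightMeasure d μ))) := by
    -- The dominating function is continuous on the compact ball, hence integrable for the finite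
    -- measure `W_μ`, and it does not involve `n`.
    refine tendsto_integral_of_dominated_convergence
      (fun x => |inner ℝ (smoothGrad f x) (smoothGrad g x) - diffOp μ f x * g x| +
        |g x| * (2 * C * |ballDeriv f x (x : Space d)|)) (fun n => ?_) ?_ (fun n => ?_) ?_
    · have hcut : Continuous fun x : Ball d => cutoff n (x : Space d) :=
        (contDiff_cutoff n).continuous.comp continuous_subtype_val
      exact ((hcut.mul (hin.sub hLg)).add
        (hgc.mul (continuous_cutoffDeriv n hf))).aestronglyMeasurable
    · exact integrable_continuous ((hin.sub hLg).abs.add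
        (hgc.abs.mul (continuous_const.mul hdf.abs)))
    · refine Eventually.of_forall fun x => ?_
      have hs := one_sub_normSq_nonneg x
      have ht : (n : ℝ) * (1 - ‖(x : Space d)‖ ^ 2) - 1 ≥ -1 := by
        linarith [mul_nonneg (n.cast_nonneg : (0 : ℝ) ≤ n) hs]
      refine (norm_add_le _ _).trans (add_le_add ?_ ?_)
      · rw [norm_mul, cutoff, Real.norm_of_nonneg (Real.smoothTransition.nonneg _)]
        exact mul_le_of_le_one_left (norm_nonneg _) (Real.smoothTransition.le_one _)
      · rw [norm_mul, cutoffDeriv, norm_mul, norm_mul]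
        simp only [Real.norm_eq_abs]
        have h2 : |(-2 : ℝ)| = 2 := by norm_num
        rw [h2]
        gcongr
        exact hC _ ht
    -- At an interior point the cut-off function is `1` and its derivative `0` as soon as `n(1 -
    -- |x|²) > 2`.
    · filter_upwards [ae_weightMeasure_mem hd μ] with x hx
      have hs := one_sub_normSq_pos hx.1
      refine tendsto_const_nhds.congr' ?_
      have h1 : Tendsto (fun n : ℕ => (n : ℝ) * (1 - ‖(x : Space d)‖ ^ 2)) atTop atTop :=
        tendsto_natCast_atTop_atTop.atTop_mul_const hs
      filter_upwards [h1.eventually_gt_atTop 2] with n hn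
      have hn' : (n : ℝ) * (1 - ‖(x : Space d)‖ ^ 2) - 1 > 1 := by linarith
      rw [cutoff, cutoffDeriv, Real.smoothTransition.one_of_one_le hn'.le, hzero _ hn']
      ring
  simp only [integral_cutoff_eq_zero hd hf hg] at hlim
  have h0 := tendsto_nhds_unique hlim tendsto_const_nhds
  rw [integral_sub (integrable_continuous hin) (integrable_continuous hLg)] at h0
  linarith

/-- The punctured open unit ball. -/
abbrev punctured (d : ℕ) : Set (Space d) := Metric.ball 0 1 \ {0}

theorem isOpen_punctured : IsOpen (punctured d) :=
  Metric.isOpen_ball.sdiff isClosed_singleton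

theorem measurableEmbedding_ball : MeasurableEmbedding (Subtype.val : Ball d → Space d) :=
  MeasurableEmbedding.subtype_coe Metric.isClosed_closedBall.measurableSet

instance : IsFiniteMeasure (lebesgue d) := by
  refine ⟨?_⟩
  rw [lebesgue, measurableEmbedding_ball.comap_apply, Set.image_univ, Subtype.range_coe]
  exact (isCompact_closedBall _ _).measure_lt_top

/-! ### Local square integrability -/

theorem measurableSet_preimage_compact {K : Set (Space d)} (hK : IsCompact K) :
    MeasurableSet {x : Ball d | (x : Space d) ∈ K} :=
  measurable_subtype_coe hK.isClosed.measurableSet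

section L2Loc

variable {F : Type*} [NormedAddCommGroup F]

/-- On a compact subset of the open ball the weight is bounded below, so Lebesgue measure there is
at most a multiple of `W_μ`. -/
theorem isL2Loc_of_memLp {μ : ℝ} {h : Ball d → F} (hh : MemLp h 2 (weightMeasure d μ)) :
    IsL2Loc h := by
  intro K hK hKs
  have hwc : ContinuousOn (fun x : Space d => (weight μ x)⁻¹) K :=
    (((contDiffOn_weight μ).continuousOn.inv₀ fun x hx => (weight_pos μ hx).ne').mono
      (hKs.trans Set.sdiff_subset))
  obtain ⟨C, hC⟩ := hK.exists_bound_of_continuousOn hwc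
  have hle : (lebesgue d).restrict {x | (x : Space d) ∈ K} ≤
      ENNReal.ofReal C • weightMeasure d μ := by
    refine Measure.le_iff.2 fun s hs => ?_
    have hms := hs.inter (measurableSet_preimage_compact hK)
    rw [Measure.restrict_apply hs, Measure.smul_apply, smul_eq_mul]
    refine le_trans ?_ (mul_le_mul_right (measure_mono
      (Set.inter_subset_left (t := {x : Ball d | (x : Space d) ∈ K}))) _)
    rw [weightMeasure, withDensity_apply _ hms, ← lintegral_const_mul']
    swap; · exact ENNReal.ofReal_ne_top
    rw [← setLIntegral_one]
    refine setLIntegral_mono' hms fun x hx => ?_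
    have hw := weight_pos μ (hKs hx.2).1
    have hCx := hC _ hx.2
    have hC0 : 0 ≤ C := (norm_nonneg _).trans hCx
    rw [← ENNReal.ofReal_mul hC0, ← ENNReal.ofReal_one]
    refine ENNReal.ofReal_le_ofReal ?_
    rw [norm_inv, Real.norm_of_nonneg hw.le, inv_le_iff_one_le_mul₀ hw] at hCx
    exact hCx
  exact hh.of_measure_le_smul ENNReal.ofReal_ne_top hle

theorem IsL2Loc.sub {h k : Ball d → F} (hh : IsL2Loc h) (hk : IsL2Loc k) :
    IsL2Loc fun x => h x - k x := fun K hK hKs => (hh K hK hKs).sub (hk K hK hKs)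

theorem IsL2Loc.congr {h k : Ball d → F} (hh : IsL2Loc h) (hk : h =ᵐ[lebesgue d] k) :
    IsL2Loc k := fun K hK hKs => (hh K hK hKs).ae_eq (ae_restrict_of_ae hk)

theorem IsL2Loc.smul [NormedSpace ℝ F] {h : Ball d → F} (hh : IsL2Loc h) {a : Space d → ℝ}
    (ha : ContinuousOn a (punctured d)) (ham : Measurable a) :
    IsL2Loc fun x : Ball d => a x • h x := by
  intro K hK hKs
  obtain ⟨C, hC⟩ := hK.exists_bound_of_continuousOn (ha.mono hKs)
  refine (hh K hK hKs).of_le_mul (c := C)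
    ((ham.comp measurable_subtype_coe).aestronglyMeasurable.smul (hh K hK hKs).1) ?_
  filter_upwards [ae_restrict_mem (measurableSet_preimage_compact hK)] with x hx
  rw [norm_smul]
  exact mul_le_mul_of_nonneg_right (hC x hx) (norm_nonneg _)

variable {F' : Type*} [NormedAddCommGroup F']

theorem IsL2Loc.integrable_of_le {h : Ball d → F} (hh : IsL2Loc h) {K : Set (Space d)}
    (hK : IsCompact K) (hKs : K ⊆ punctured d) {f : Ball d → F'}
    (hf0 : ∀ x : Ball d, (x : Space d) ∉ K → f x = 0)
    (hf : AEStronglyMeasurable f ((lebesgue d).restrict {x | (x : Space d) ∈ K})) {C : ℝ}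
    (hC : ∀ x, ‖f x‖ ≤ C * ‖h x‖) : Integrable f (lebesgue d) := by
  have hsupp : Function.support f ⊆ {x : Ball d | (x : Space d) ∈ K} := fun x hx => by
    by_contra hc
    exact hx (hf0 x hc)
  rw [← integrableOn_iff_integrable_of_support_subset hsupp]
  exact ((hh K hK hKs).of_le_mul hf (Eventually.of_forall hC)).integrable one_le_two

end L2Loc

/-! ### Test functions -/

section Test

variable {F : Type*} [NormedAddCommGroup F] [NormedSpace ℝ F]

theorem tsupport_subset_tsupport {F : Type*} [NormedAddCommGroup F] {φ : Space d → ℝ}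
    {k : Space d → F} (h0 : ∀ x ∉ tsupport φ, k x = 0) : tsupport k ⊆ tsupport φ := by
  refine closure_minimal (fun x hx => ?_) (isClosed_tsupport φ)
  by_contra hc
  exact hx (h0 x hc)

/-- The support of a test function stays away from the origin and the sphere, so factors such as
`|x|⁻¹` or `W⁻¹`, continuous only in the punctured ball, do no harm. -/
theorem IsTest.continuous_of_continuousOn {F : Type*} [NormedAddCommGroup F]
    {φ : Space d → ℝ} (hφ : IsTest φ) {k : Space d → F}
    (hk : ContinuousOn k (punctured d)) (h0 : ∀ x ∉ tsupport φ, k x = 0) :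
    Continuous k ∧ HasCompactSupport k := by
  have hsub := tsupport_subset_tsupport h0
  exact ⟨hk.continuous_of_tsupport_subset isOpen_punctured (hsub.trans hφ.2.2),
    HasCompactSupport.of_support_subset_isCompact hφ.2.1 ((subset_tsupport k).trans hsub)⟩

theorem IsTest.integrable_smul {φ : Space d → ℝ} (hφ : IsTest φ) {k : Space d → ℝ}
    (hk : ContinuousOn k (punctured d)) (h0 : ∀ x ∉ tsupport φ, k x = 0) {h : Ball d → F}
    (hh : IsL2Loc h) : Integrable (fun x : Ball d => k x • h x) (lebesgue d) := by
  obtain ⟨hc, hs⟩ := hφ.continuous_of_continuousOn hk h0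
  obtain ⟨C, hC⟩ := hs.exists_bound_of_continuous hc
  refine hh.integrable_of_le hφ.2.1 hφ.2.2 (fun x hx => by rw [h0 x hx, zero_smul])
    ((hc.comp continuous_subtype_val).aestronglyMeasurable.smul (hh _ hφ.2.1 hφ.2.2).1) (C := C)
    fun x => ?_
  rw [norm_smul]
  exact mul_le_mul_of_nonneg_right (hC x) (norm_nonneg _)

theorem IsTest.integrable_smul' {φ : Space d → ℝ} (hφ : IsTest φ) {k : Space d → F}
    (hk : ContinuousOn k (punctured d)) (h0 : ∀ x ∉ tsupport φ, k x = 0) {h : Ball d → ℝ}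
    (hh : IsL2Loc h) : Integrable (fun x : Ball d => h x • k x) (lebesgue d) := by
  obtain ⟨hc, hs⟩ := hφ.continuous_of_continuousOn hk h0
  obtain ⟨C, hC⟩ := hs.exists_bound_of_continuous hc
  refine hh.integrable_of_le hφ.2.1 hφ.2.2 (fun x hx => by rw [h0 x hx, smul_zero])
    ((hh _ hφ.2.1 hφ.2.2).1.smul (hc.comp continuous_subtype_val).aestronglyMeasurable) (C := C)
    fun x => ?_
  rw [norm_smul, mul_comm]
  exact mul_le_mul_of_nonneg_right (hC x) (norm_nonneg _)

/-- A locally square integrable function that annihilates all test functions vanishes. -/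
theorem ae_eq_zero_of_forall_test [CompleteSpace F] (hd : 2 ≤ d) {h : Ball d → F}
    (hh : IsL2Loc h) (h0 : ∀ φ : Space d → ℝ, IsTest φ → ∫ x : Ball d, φ x • h x ∂(lebesgue d) = 0) :
    h =ᵐ[lebesgue d] 0 := by
  classical
  -- Extension by zero transfers the statement to the whole space, where the fundamental lemma of
  -- the calculus of variations applies on the punctured ball.
  let e : Space d → F := fun x => if hx : x ∈ ballSet d then h ⟨x, hx⟩ else 0
  have he : ∀ x : Ball d, e x = h x := fun x => dif_pos x.2
  have hli : LocallyIntegrableOn e (punctured d) volume := by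
    rw [locallyIntegrableOn_iff isOpen_punctured.isLocallyClosed]
    intro K hKs hK
    have hKr : K ⊆ Set.range (Subtype.val : Ball d → Space d) := by
      rw [Subtype.range_coe]
      exact hKs.trans (Set.sdiff_subset.trans Metric.ball_subset_closedBall)
    rw [measurableEmbedding_ball.integrableOn_iff_comap hKr]
    have : e ∘ (Subtype.val : Ball d → Space d) = h := funext he
    rw [this]
    exact (hh K hK hKs).integrable one_le_two
  have hz := isOpen_punctured.ae_eq_zero_of_integral_contDiff_smul_eq_zero hli
    fun g hg hgc hgs => by
      rw [← h0 g ⟨hg.of_le (by exact_mod_cast le_top), hgc, hgs⟩]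
      have h1 : ∫ x : Ball d, g x • h x ∂(lebesgue d) = ∫ x in ballSet d, g x • e x := by
        rw [← integral_lebesgue fun x => g x • e x]
        simp only [he]
      rw [h1, setIntegral_eq_integral_of_forall_compl_eq_zero]
      intro x hx
      simp only [e, dif_neg hx, smul_zero]
  have hz' : ∀ᵐ x : Ball d ∂(lebesgue d), (x : Space d) ∈ punctured d → e x = 0 := by
    rw [ae_iff, lebesgue, measurableEmbedding_ball.comap_apply]
    refine measure_mono_null ?_ (ae_iff.1 hz)
    rintro _ ⟨x, hx, rfl⟩
    exact hx
  filter_upwards [hz', ae_lebesgue_mem hd] with x h1 h2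
  rw [← he]
  exact h1 h2

end Test

/-! ### Weak derivatives -/

/-- The adjoint of the radial derivative, up to the sign. -/
def radialDiv (φ : Space d → ℝ) (x : Space d) : ℝ :=
  classicalRadialDeriv φ x + ((d : ℝ) - 1) / ‖x‖ * φ x

/-- The adjoint of the spherical gradient, up to the sign. -/
def sphDiv (φ : Space d → ℝ) (x : Space d) : Space d :=
  classicalSphGrad φ x - (((d : ℝ) - 1) * φ x) • (‖x‖⁻¹ • x)

theorem continuousOn_norm_inv : ContinuousOn (fun x : Space d => ‖x‖⁻¹) (punctured d) :=
  continuous_norm.continuousOn.inv₀ fun _ hx => norm_ne_zero_iff.2 hx.2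

theorem IsTest.continuousOn_classicalRadialDeriv {φ : Space d → ℝ} (hφ : IsTest φ) :
    ContinuousOn (classicalRadialDeriv φ) (punctured d) :=
  (hφ.1.continuous_fderiv (by norm_num)).continuousOn.clm_apply
    (continuousOn_norm_inv.smul continuousOn_id)

theorem IsTest.continuousOn_radialDiv {φ : Space d → ℝ} (hφ : IsTest φ) :
    ContinuousOn (radialDiv φ) (punctured d) :=
  hφ.continuousOn_classicalRadialDeriv.add
    ((continuousOn_const.mul continuousOn_norm_inv).mul hφ.1.continuous.continuousOn)

theorem IsTest.continuousOn_sphDiv {φ : Space d → ℝ} (hφ : IsTest φ) :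
    ContinuousOn (sphDiv φ) (punctured d) := by
  have h1 : Continuous (gradient φ) :=
    (LinearIsometryEquiv.continuous _).comp (hφ.1.continuous_fderiv (by norm_num))
  exact ((continuous_norm.continuousOn.smul h1.continuousOn).sub
    (hφ.continuousOn_classicalRadialDeriv.smul continuousOn_id)).sub
    ((continuousOn_const.mul hφ.1.continuous.continuousOn).smul
      (continuousOn_norm_inv.smul continuousOn_id))

theorem classicalRadialDeriv_eq_zero {φ : Space d → ℝ} {x : Space d} (hx : x ∉ tsupport φ) :
    classicalRadialDeriv φ x = 0 := by
  rw [classicalRadialDeriv, fderiv_of_notMem_tsupport ℝ hx]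
  rfl

theorem radialDiv_eq_zero {φ : Space d → ℝ} {x : Space d} (hx : x ∉ tsupport φ) :
    radialDiv φ x = 0 := by
  rw [radialDiv, classicalRadialDeriv_eq_zero hx, image_eq_zero_of_notMem_tsupport hx]
  simp

theorem sphDiv_eq_zero {φ : Space d → ℝ} {x : Space d} (hx : x ∉ tsupport φ) :
    sphDiv φ x = 0 := by
  rw [sphDiv, classicalSphGrad, classicalRadialDeriv_eq_zero hx,
    image_eq_zero_of_notMem_tsupport hx, gradient, fderiv_of_notMem_tsupport ℝ hx]
  simp

theorem HasRadialDeriv.congr {f f' g : Ball d → ℝ} (h : HasRadialDeriv f g)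
    (hf : f =ᵐ[lebesgue d] f') : HasRadialDeriv f' g := by
  refine ⟨h.1.congr hf, h.2.1, fun φ hφ => ?_⟩
  rw [h.2.2 φ hφ]
  congr 1
  refine integral_congr_ae ?_
  filter_upwards [hf] with x hx
  rw [hx]

theorem HasSphGrad.congr {f f' : Ball d → ℝ} {g : Ball d → Space d} (h : HasSphGrad f g)
    (hf : f =ᵐ[lebesgue d] f') : HasSphGrad f' g := by
  refine ⟨h.1.congr hf, h.2.1, fun φ hφ => ?_⟩
  rw [h.2.2 φ hφ]
  congr 1
  refine integral_congr_ae ?_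
  filter_upwards [hf] with x hx
  rw [hx]

theorem IsTest.integrable_self_smul {F : Type*} [NormedAddCommGroup F] [NormedSpace ℝ F]
    {φ : Space d → ℝ} (hφ : IsTest φ) {h : Ball d → F} (hh : IsL2Loc h) :
    Integrable (fun x : Ball d => φ x • h x) (lebesgue d) :=
  hφ.integrable_smul hφ.1.continuous.continuousOn
    (fun _ hx => image_eq_zero_of_notMem_tsupport hx) hh

theorem IsTest.integrable_mul_self {φ : Space d → ℝ} (hφ : IsTest φ) {h : Ball d → ℝ}
    (hh : IsL2Loc h) : Integrable (fun x : Ball d => h x * φ x) (lebesgue d) :=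
  (hφ.integrable_self_smul hh).congr (Eventually.of_forall fun _ => mul_comm _ _)

theorem HasRadialDeriv.sub {f g f' g' : Ball d → ℝ} (h : HasRadialDeriv f g)
    (h' : HasRadialDeriv f' g') :
    HasRadialDeriv (fun x => f x - f' x) fun x => g x - g' x := by
  refine ⟨h.1.sub h'.1, h.2.1.sub h'.2.1, fun φ hφ => ?_⟩
  have hf := hφ.integrable_smul' hφ.continuousOn_radialDiv (fun _ => radialDiv_eq_zero) h.1
  have hf' := hφ.integrable_smul' hφ.continuousOn_radialDiv (fun _ => radialDiv_eq_zero) h'.1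
  simp only [sub_mul]
  rw [integral_sub (hφ.integrable_mul_self h.2.1) (hφ.integrable_mul_self h'.2.1), h.2.2 φ hφ,
    h'.2.2 φ hφ]
  have := integral_sub hf hf'
  simp only [smul_eq_mul, radialDiv] at this
  rw [this]
  ring

theorem HasSphGrad.sub {f f' : Ball d → ℝ} {g g' : Ball d → Space d} (h : HasSphGrad f g)
    (h' : HasSphGrad f' g') :
    HasSphGrad (fun x => f x - f' x) fun x => g x - g' x := by
  refine ⟨h.1.sub h'.1, h.2.1.sub h'.2.1, fun φ hφ => ?_⟩
  have hf := hφ.integrable_smul' hφ.continuousOn_sphDiv (fun _ => sphDiv_eq_zero) h.1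
  have hf' := hφ.integrable_smul' hφ.continuousOn_sphDiv (fun _ => sphDiv_eq_zero) h'.1
  have := integral_sub hf hf'
  simp only [sphDiv] at this
  simp only [smul_sub (φ _), sub_smul (f _) (f' _)]
  rw [integral_sub (hφ.integrable_self_smul h.2.1) (hφ.integrable_self_smul h'.2.1), h.2.2 φ hφ,
    h'.2.2 φ hφ, this]
  module

theorem HasRadialDeriv.unique (hd : 2 ≤ d) {f g g' : Ball d → ℝ} (h : HasRadialDeriv f g)
    (h' : HasRadialDeriv f g') : g =ᵐ[lebesgue d] g' := by
  have h0 := ae_eq_zero_of_forall_test hd (h.2.1.sub h'.2.1) fun φ hφ => by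
    simp only [smul_sub]
    rw [integral_sub (hφ.integrable_self_smul h.2.1) (hφ.integrable_self_smul h'.2.1)]
    have h1 := h.2.2 φ hφ
    rw [← h'.2.2 φ hφ] at h1
    simp only [smul_eq_mul, mul_comm (φ _)]
    rw [h1, sub_self]
  filter_upwards [h0] with x hx using sub_eq_zero.1 hx

theorem HasSphGrad.unique (hd : 2 ≤ d) {f : Ball d → ℝ} {g g' : Ball d → Space d}
    (h : HasSphGrad f g) (h' : HasSphGrad f g') : g =ᵐ[lebesgue d] g' := by
  have h0 := ae_eq_zero_of_forall_test hd (h.2.1.sub h'.2.1) fun φ hφ => by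
    simp only [smul_sub]
    rw [integral_sub (hφ.integrable_self_smul h.2.1) (hφ.integrable_self_smul h'.2.1),
      h.2.2 φ hφ, h'.2.2 φ hφ, sub_self]
  filter_upwards [h0] with x hx using sub_eq_zero.1 hx

theorem hasRadialDeriv_radialDeriv {f : Ball d → ℝ} (h : ∃ g, HasRadialDeriv f g) :
    HasRadialDeriv f (radialDeriv f) := by
  rw [radialDeriv, dif_pos h]
  exact h.choose_spec

theorem hasSphGrad_sphGrad {f : Ball d → ℝ} (h : ∃ g, HasSphGrad f g) :
    HasSphGrad f (sphGrad f) := by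
  rw [sphGrad, dif_pos h]
  exact h.choose_spec

/-- The radial derivative encoded by a weighted gradient. -/
def radialPart (Z : Ball d → GradSpace d) (x : Ball d) : ℝ :=
  (√(1 - ‖(x : Space d)‖ ^ 2))⁻¹ * (Z x).fst

/-- The spherical gradient encoded by a weighted gradient. -/
def sphPart (Z : Ball d → GradSpace d) (x : Ball d) : Space d :=
  ‖(x : Space d)‖ • (Z x).snd

theorem hasFDerivAt_norm_of_ne {x : Space d} (hx : x ≠ 0) :
    HasFDerivAt (fun y : Space d => ‖y‖) (‖x‖⁻¹ • innerSL ℝ x) x := by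
  have h := (hasStrictFDerivAt_norm_sq x).hasFDerivAt.sqrt
    (pow_ne_zero 2 (norm_ne_zero_iff.2 hx))
  simp only [Real.sqrt_sq (norm_nonneg _)] at h
  refine h.congr_fderiv ?_
  ext v
  simp
  field_simp

theorem hasFDerivAt_norm_inv {x : Space d} (hx : x ≠ 0) :
    HasFDerivAt (fun y : Space d => ‖y‖⁻¹) (-(‖x‖ ^ 2)⁻¹ • (‖x‖⁻¹ • innerSL ℝ x)) x :=
  (hasDerivAt_inv (norm_ne_zero_iff.2 hx)).comp_hasFDerivAt x (hasFDerivAt_norm_of_ne hx)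

theorem contDiffOn_norm : ContDiffOn ℝ 1 (fun x : Space d => ‖x‖) (punctured d) :=
  fun _ hx => (contDiffAt_norm ℝ hx.2).contDiffWithinAt

theorem contDiffOn_norm_inv : ContDiffOn ℝ 1 (fun x : Space d => ‖x‖⁻¹) (punctured d) :=
  contDiffOn_norm.inv fun _ hx => norm_ne_zero_iff.2 hx.2

theorem IsC2.contDiffOn_punctured {f : Space d → ℝ} (hf : IsC2 f) :
    ContDiffOn ℝ 1 f (punctured d) :=
  (ContDiffOn.mono hf (Set.sdiff_subset.trans Metric.ball_subset_closedBall)).of_le (by norm_num)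

theorem IsC2.hasFDerivAt {f : Space d → ℝ} (hf : IsC2 f) {x : Space d}
    (hx : x ∈ Metric.ball (0 : Space d) 1) : HasFDerivAt f (ballDeriv f x) x := by
  rw [ballDeriv_eq hx]
  exact ((ContDiffOn.contDiffAt hf (ballSet_mem_nhds hx)).differentiableAt
    (by norm_num)).hasFDerivAt

theorem IsTest.hasFDerivAt {φ : Space d → ℝ} (hφ : IsTest φ) (x : Space d) :
    HasFDerivAt φ (fderiv ℝ φ x) x :=
  (hφ.1.differentiable (by norm_num) x).hasFDerivAt

theorem punctured_subset : punctured d ⊆ ballSet d :=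
  Set.sdiff_subset.trans Metric.ball_subset_closedBall

theorem radialPart_smoothGrad (f : Space d → ℝ) {x : Ball d}
    (hx : (x : Space d) ∈ punctured d) :
    radialPart (smoothGrad f) x = ‖(x : Space d)‖⁻¹ * ballDeriv f x x := by
  have hs : √(1 - ‖(x : Space d)‖ ^ 2) ≠ 0 := (Real.sqrt_pos.2 (one_sub_normSq_pos hx.1)).ne'
  change _⁻¹ * (_ * _) = _
  rw [inv_mul_cancel_left₀ hs]

theorem sphPart_smoothGrad (f : Space d → ℝ) {x : Ball d} (hx : (x : Space d) ∈ punctured d) :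
    sphPart (smoothGrad f) x =
      ‖(x : Space d)‖ • (InnerProductSpace.toDual ℝ (Space d)).symm (ballDeriv f x) -
        (‖(x : Space d)‖⁻¹ * ballDeriv f x x) • (x : Space d) := by
  have hn : ‖(x : Space d)‖ ≠ 0 := norm_ne_zero_iff.2 hx.2
  change _ • (_ - _) = _
  rw [smul_sub, smul_smul]
  congr 2
  field_simp

/-- The integrand is the divergence of `fφ x/|x|`; the term `(d - 1)/|x|` is `div(x/|x|)`. -/
theorem integral_radialPart_smoothGrad (hd : 2 ≤ d) {f : Space d → ℝ} (hf : IsC2 f)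
    {φ : Space d → ℝ} (hφ : IsTest φ) :
    ∫ x : Ball d, (φ x * radialPart (smoothGrad f) x + f x * radialDiv φ x) ∂(lebesgue d) = 0 := by
  have h0 : ∀ x ∉ tsupport φ, (f x * φ x * ‖x‖⁻¹) • x = 0 := fun x hx => by
    rw [image_eq_zero_of_notMem_tsupport hx, mul_zero, zero_mul, zero_smul]
  have hsub := tsupport_subset_tsupport h0
  have hC : ContDiffOn ℝ 1 (fun x : Space d => (f x * φ x * ‖x‖⁻¹) • x) (punctured d) :=
    ((hf.contDiffOn_punctured.mul hφ.1.contDiffOn).mul contDiffOn_norm_inv).smul contDiffOn_id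
  rw [← integral_lebesgue_divergence_eq_zero isOpen_punctured punctured_subset hC
    (hφ.2.1.of_isClosed_subset (isClosed_tsupport _) hsub) (hsub.trans hφ.2.2)]
  refine integral_congr_ae ?_
  filter_upwards [ae_lebesgue_mem hd] with x hx
  have hn : ‖(x : Space d)‖ ≠ 0 := norm_ne_zero_iff.2 hx.2
  have ha : HasFDerivAt (fun y : Space d => f y * φ y * ‖y‖⁻¹) _ (x : Space d) :=
    ((hf.hasFDerivAt hx.1).mul (hφ.hasFDerivAt x)).mul (hasFDerivAt_norm_inv hx.2)
  rw [divergence_smul (Y := fun y => y) ha differentiableAt_fun_id, divergence_id,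
    radialPart_smoothGrad f hx, radialDiv, classicalRadialDeriv, map_smul]
  simp only [_root_.add_apply, _root_.smul_apply, smul_eq_mul, innerSL_apply_apply,
    real_inner_self_eq_norm_sq, Pi.mul_apply]
  field_simp
  ring

/-- The integrand is the divergence of `fφ (|x| e - (e · x) x/|x|)`. The derivative of `fφ` along
the bracket is `e · ∇₀(fφ)`, and the bracket has divergence `-(d - 1)(e · x)/|x|`. -/
theorem integral_sphPart_smoothGrad (hd : 2 ≤ d) {f : Space d → ℝ} (hf : IsC2 f)
    {φ : Space d → ℝ} (hφ : IsTest φ) (e : Space d) :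
    ∫ x : Ball d, (φ x * inner ℝ e (sphPart (smoothGrad f) x) + f x * inner ℝ e (sphDiv φ x))
      ∂(lebesgue d) = 0 := by
  have h0 : ∀ x ∉ tsupport φ, (f x * φ x * ‖x‖) • e -
      (f x * φ x * ‖x‖⁻¹ * inner ℝ e x) • x = 0 := fun x hx => by
    simp [image_eq_zero_of_notMem_tsupport hx]
  have hsub := tsupport_subset_tsupport h0
  have hfφ := hf.contDiffOn_punctured.mul (hφ.1.contDiffOn (s := punctured d))
  have hie : ContDiffOn ℝ 1 (fun x : Space d => inner ℝ e x) (punctured d) :=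
    (innerSL ℝ e).contDiff.contDiffOn
  have hC : ContDiffOn ℝ 1 (fun x : Space d => (f x * φ x * ‖x‖) • e -
      (f x * φ x * ‖x‖⁻¹ * inner ℝ e x) • x) (punctured d) :=
    ((hfφ.mul contDiffOn_norm).smul contDiffOn_const).sub
      (((hfφ.mul contDiffOn_norm_inv).mul hie).smul contDiffOn_id)
  rw [← integral_lebesgue_divergence_eq_zero isOpen_punctured punctured_subset hC
    (hφ.2.1.of_isClosed_subset (isClosed_tsupport _) hsub) (hsub.trans hφ.2.2)]
  refine integral_congr_ae ?_
  filter_upwards [ae_lebesgue_mem hd] with x hx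
  have hn : ‖(x : Space d)‖ ≠ 0 := norm_ne_zero_iff.2 hx.2
  have hfφ' := (hf.hasFDerivAt hx.1).mul (hφ.hasFDerivAt x)
  have ha : HasFDerivAt (fun y : Space d => f y * φ y * ‖y‖) _ (x : Space d) :=
    hfφ'.mul (hasFDerivAt_norm_of_ne hx.2)
  have hb : HasFDerivAt (fun y : Space d => f y * φ y * ‖y‖⁻¹ * inner ℝ e y) _ (x : Space d) :=
    (hfφ'.mul (hasFDerivAt_norm_inv hx.2)).mul ((innerSL ℝ e).hasFDerivAt (x := (x : Space d)))
  have hgrad : ∀ L : Space d →L[ℝ] ℝ,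
      inner ℝ e ((InnerProductSpace.toDual ℝ (Space d)).symm L) = L e := fun L => by
    rw [real_inner_comm, InnerProductSpace.toDual_symm_apply]
  have hda : DifferentiableAt ℝ (fun y : Space d => (f y * φ y * ‖y‖) • e) x :=
    ha.differentiableAt.smul (differentiableAt_const e)
  have hdb : DifferentiableAt ℝ (fun y : Space d => (f y * φ y * ‖y‖⁻¹ * inner ℝ e y) • y) x :=
    hb.differentiableAt.smul differentiableAt_fun_id
  rw [divergence_sub hda hdb,
    divergence_smul (Y := fun _ => e) ha (differentiableAt_const e), divergence_const,
    divergence_smul (Y := fun y => y) hb differentiableAt_fun_id, divergence_id,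
    sphPart_smoothGrad f hx, sphDiv, classicalSphGrad, classicalRadialDeriv, map_smul, gradient]
  simp only [_root_.add_apply, _root_.smul_apply, smul_eq_mul, innerSL_apply_apply,
    real_inner_self_eq_norm_sq, Pi.mul_apply, inner_sub_right, real_inner_smul_right, hgrad]
  rw [real_inner_comm e (x : Space d)]
  field_simp
  ring

/-! ### The graph of the weighted gradient -/

variable {μ : ℝ}

theorem smoothGrad_add {f g : Space d → ℝ} (hf : IsC2 f) (hg : IsC2 g) (x : Ball d) :
    smoothGrad (fun y => f y + g y) x = smoothGrad f x + smoothGrad g x := by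
  rw [smoothGrad, smoothGrad, smoothGrad, ← gradSymbol_add]
  congr 1
  exact fderivWithin_fun_add (uniqueDiffOn_ballSet _ x.2)
    (ContDiffOn.differentiableOn hf (by norm_num) _ x.2)
    (ContDiffOn.differentiableOn hg (by norm_num) _ x.2)

theorem smoothGrad_comp {φ : ℝ → ℝ} (hφ : ContDiff ℝ 2 φ) {f : Space d → ℝ} (hf : IsC2 f)
    (x : Ball d) : smoothGrad (fun y => φ (f y)) x = deriv φ (f x) • smoothGrad f x := by
  rw [smoothGrad, smoothGrad, ← gradSymbol_smul]
  congr 1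
  have h1 := (ContDiffOn.differentiableOn hf (by norm_num) _ x.2).hasFDerivWithinAt
  have h2 := (hφ.differentiable (by norm_num) (f x)).hasDerivAt
  exact (h2.comp_hasFDerivWithinAt (x : Space d) h1).fderivWithin (uniqueDiffOn_ballSet _ x.2)

theorem smoothGrad_const_smul (c : ℝ) {f : Space d → ℝ} (hf : IsC2 f) (x : Ball d) :
    smoothGrad (fun y => c * f y) x = c • smoothGrad f x := by
  rw [smoothGrad_comp (φ := fun t => c * t) (contDiff_const.mul contDiff_id) hf]
  congr 1
  simp

theorem smoothGrad_zero (x : Ball d) : smoothGrad (fun _ => 0) x = 0 := by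
  have := smoothGrad_const_smul 0 (f := fun _ => (0 : ℝ)) contDiffOn_const x
  simpa using this

/-- The graph of the weighted gradient on `C²(B)`. -/
def c2Graph (d : ℕ) (μ : ℝ) :
    Submodule ℝ (L2 d μ × Lp (GradSpace d) 2 (weightMeasure d μ)) where
  carrier := {p | ∃ f, IsC2 f ∧ (∀ᵐ x ∂(weightMeasure d μ), p.1 x = f x) ∧
    ∀ᵐ x ∂(weightMeasure d μ), p.2 x = smoothGrad f x}
  add_mem' := by
    rintro p q ⟨f, hf, h1, h2⟩ ⟨g, hg, h3, h4⟩
    refine ⟨fun y => f y + g y, ContDiffOn.add hf hg, ?_, ?_⟩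
    · filter_upwards [h1, h3, Lp.coeFn_add p.1 q.1] with x e1 e2 e3
      rw [Prod.fst_add, e3, Pi.add_apply, e1, e2]
    · filter_upwards [h2, h4, Lp.coeFn_add p.2 q.2] with x e1 e2 e3
      rw [Prod.snd_add, e3, Pi.add_apply, e1, e2, smoothGrad_add hf hg]
  zero_mem' := by
    refine ⟨fun _ => 0, contDiffOn_const, Lp.coeFn_zero _ _ _, ?_⟩
    filter_upwards [Lp.coeFn_zero (GradSpace d) 2 (weightMeasure d μ)] with x e
    rw [smoothGrad_zero]
    exact e
  smul_mem' := by
    rintro c p ⟨f, hf, h1, h2⟩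
    refine ⟨fun y => c * f y, contDiffOn_const.mul hf, ?_, ?_⟩
    · filter_upwards [h1, Lp.coeFn_smul c p.1] with x e1 e2
      rw [Prod.smul_fst, e2, Pi.smul_apply, e1, smul_eq_mul]
    · filter_upwards [h2, Lp.coeFn_smul c p.2] with x e1 e2
      rw [Prod.smul_snd, e2, Pi.smul_apply, e1, smoothGrad_const_smul c hf]

/-- The graph of the closure of the weighted gradient. -/
abbrev gradGraph (d : ℕ) (μ : ℝ) :
    Submodule ℝ (L2 d μ × Lp (GradSpace d) 2 (weightMeasure d μ)) :=
  (c2Graph d μ).topologicalClosure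

/-- The left side is a continuous function of the pair in `L² × L²`, so an integration by parts
known for `C²` functions survives in the closure of the graph. -/
theorem integral_pairing_eq_zero [IsFiniteMeasure (weightMeasure d μ)] {k : Space d → GradSpace d}
    {l : Space d → ℝ} (hk : Continuous k) (hl : Continuous l)
    (h0 : ∀ f, IsC2 f → ∫ x : Ball d, (inner ℝ (k x) (smoothGrad f x) + f x * l x)
      ∂(weightMeasure d μ) = 0)
    {p : L2 d μ × Lp (GradSpace d) 2 (weightMeasure d μ)} (hp : p ∈ gradGraph d μ) :
    ∫ x : Ball d, inner ℝ (k x) (p.2 x) ∂(weightMeasure d μ) +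
      ∫ x : Ball d, p.1 x * l x ∂(weightMeasure d μ) = 0 := by
  have hkL : MemLp (fun x : Ball d => k x) 2 (weightMeasure d μ) :=
    memLp_continuous (hk.comp continuous_subtype_val) 2
  have hlL : MemLp (fun x : Ball d => l x) 2 (weightMeasure d μ) :=
    memLp_continuous (hl.comp continuous_subtype_val) 2
  have e1 : ∀ Z : Lp (GradSpace d) 2 (weightMeasure d μ),
      inner ℝ (hkL.toLp _) Z = ∫ x : Ball d, inner ℝ (k x) (Z x) ∂(weightMeasure d μ) := fun Z => by
    rw [L2.inner_def]
    refine integral_congr_ae ?_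
    filter_upwards [hkL.coeFn_toLp] with x hx
    rw [hx]
  have e2 : ∀ u : L2 d μ,
      inner ℝ (hlL.toLp _) u = ∫ x : Ball d, u x * l x ∂(weightMeasure d μ) := fun u => by
    rw [L2.inner_def]
    refine integral_congr_ae ?_
    filter_upwards [hlL.coeFn_toLp] with x hx
    rw [hx]
    rfl
  rw [← e1, ← e2]
  let T : L2 d μ × Lp (GradSpace d) 2 (weightMeasure d μ) → ℝ := fun q =>
    inner ℝ (hkL.toLp _) q.2 + inner ℝ (hlL.toLp _) q.1
  have hcl : IsClosed {q | T q = 0} := isClosed_eq (by fun_prop) continuous_const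
  have hsub : closure (c2Graph d μ : Set _) ⊆ {q | T q = 0} := by
    refine closure_minimal ?_ hcl
    rintro q ⟨f, hf, h1, h2⟩
    change inner ℝ (hkL.toLp _) q.2 + inner ℝ (hlL.toLp _) q.1 = 0
    rw [← h0 f hf, L2.inner_def, L2.inner_def,
      ← integral_add (L2.integrable_inner _ _) (L2.integrable_inner _ _)]
    refine integral_congr_ae ?_
    filter_upwards [h1, h2, hkL.coeFn_toLp, hlL.coeFn_toLp] with x a1 a2 a3 a4
    rw [a1, a2, a3, a4]
    rfl
  exact hsub hp

theorem norm_fst_le (z : GradSpace d) : ‖z.fst‖ ≤ ‖z‖ := by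
  rw [WithLp.prod_norm_eq_of_L2]
  exact Real.le_sqrt_of_sq_le (by nlinarith [sq_nonneg ‖z.snd‖])

theorem norm_snd_le (z : GradSpace d) : ‖z.snd‖ ≤ ‖z‖ := by
  rw [WithLp.prod_norm_eq_of_L2]
  exact Real.le_sqrt_of_sq_le (by nlinarith [sq_nonneg ‖z.fst‖])

theorem norm_toLp_le (a : ℝ) (b : Space d) : ‖(WithLp.toLp 2 (a, b) : GradSpace d)‖ ≤ ‖a‖ + ‖b‖ := by
  rw [WithLp.prod_norm_eq_of_L2]
  refine Real.sqrt_le_iff.2 ⟨by positivity, ?_⟩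
  change ‖a‖ ^ 2 + ‖b‖ ^ 2 ≤ _
  nlinarith [mul_nonneg (norm_nonneg a) (norm_nonneg b)]

theorem continuous_fst' : Continuous fun z : GradSpace d => z.fst :=
  continuous_fst.comp (WithLp.prod_continuous_ofLp 2 ℝ (Space d))

theorem continuous_snd' : Continuous fun z : GradSpace d => z.snd :=
  continuous_snd.comp (WithLp.prod_continuous_ofLp 2 ℝ (Space d))

theorem memLp_fst {m : Measure (Ball d)} {Z : Ball d → GradSpace d} (hZ : MemLp Z 2 m) :
    MemLp (fun x => (Z x).fst) 2 m :=
  hZ.of_le (continuous_fst'.comp_aestronglyMeasurable hZ.1)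
    (Eventually.of_forall fun _ => norm_fst_le _)

theorem memLp_snd {m : Measure (Ball d)} {Z : Ball d → GradSpace d} (hZ : MemLp Z 2 m) :
    MemLp (fun x => (Z x).snd) 2 m :=
  hZ.of_le (continuous_snd'.comp_aestronglyMeasurable hZ.1)
    (Eventually.of_forall fun _ => norm_snd_le _)

theorem continuousOn_sqrt_inv :
    ContinuousOn (fun x : Space d => (√(1 - ‖x‖ ^ 2))⁻¹) (punctured d) :=
  ContinuousOn.inv₀ (by fun_prop) fun _ hx => (Real.sqrt_pos.2 (one_sub_normSq_pos hx.1)).ne'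

theorem continuousOn_weight_inv (μ : ℝ) :
    ContinuousOn (fun x : Space d => (weight μ x)⁻¹) (punctured d) :=
  ((contDiffOn_weight μ).continuousOn.mono Set.sdiff_subset).inv₀
    fun _ hx => (weight_pos μ hx.1).ne'

theorem isL2Loc_radialPart (Z : Lp (GradSpace d) 2 (weightMeasure d μ)) :
    IsL2Loc (radialPart Z) :=
  (isL2Loc_of_memLp (memLp_fst (Lp.memLp Z))).smul (F := ℝ) continuousOn_sqrt_inv (by fun_prop)

theorem isL2Loc_sphPart (Z : Lp (GradSpace d) 2 (weightMeasure d μ)) :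
    IsL2Loc (sphPart Z) :=
  (isL2Loc_of_memLp (memLp_snd (Lp.memLp Z))).smul (a := fun x => ‖x‖)
    continuous_norm.continuousOn (by fun_prop)

/-- The radial derivative of a function in the domain of the closed weighted gradient. -/
theorem hasRadialDeriv_of_mem (hd : 2 ≤ d) (hμ : -(1 / 2) < μ)
    {p : L2 d μ × Lp (GradSpace d) 2 (weightMeasure d μ)} (hp : p ∈ gradGraph d μ) :
    HasRadialDeriv p.1 (radialPart p.2) := by
  have := isFiniteMeasure_weightMeasure hd hμ
  refine ⟨isL2Loc_of_memLp (Lp.memLp p.1), isL2Loc_radialPart p.2, fun φ hφ => ?_⟩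
  -- The factor `W⁻¹` converts the pairing in `L²(W_μ)` into a Lebesgue integral, and `(1 -
  -- |x|²)^{-1/2}` removes the radial weight.
  have hk := (hφ.continuous_of_continuousOn (k := fun x => (WithLp.toLp 2
      ((weight μ x)⁻¹ * (√(1 - ‖x‖ ^ 2))⁻¹ * φ x, (0 : Space d)) : GradSpace d))
    ((WithLp.prod_continuous_toLp 2 ℝ (Space d)).comp_continuousOn
      ((((continuousOn_weight_inv μ).mul continuousOn_sqrt_inv).mul
        hφ.1.continuous.continuousOn).prodMk continuousOn_const))
    fun x hx => by rw [image_eq_zero_of_notMem_tsupport hx, mul_zero]; rfl).1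
  have hl := (hφ.continuous_of_continuousOn (k := fun x => (weight μ x)⁻¹ * radialDiv φ x)
    ((continuousOn_weight_inv μ).mul hφ.continuousOn_radialDiv)
    fun x hx => by rw [radialDiv_eq_zero hx, mul_zero]).1
  have hkey : ∀ Z : Ball d → GradSpace d, ∀ x : Ball d, (x : Space d) ∈ punctured d →
      weight μ (x : Space d) * inner ℝ (WithLp.toLp 2 ((weight μ (x : Space d))⁻¹ *
        (√(1 - ‖(x : Space d)‖ ^ 2))⁻¹ * φ x, (0 : Space d)) : GradSpace d) (Z x) =
      φ x * radialPart Z x := fun Z x hx => by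
    have hw := (weight_pos μ hx.1).ne'
    rw [WithLp.prod_inner_apply]
    simp only [inner_zero_left, add_zero, RCLike.inner_apply, conj_trivial, radialPart,
      WithLp.fst]
    field_simp
  have h := integral_pairing_eq_zero hk hl (fun f hf => ?_) hp
  · rw [integral_weightMeasure, integral_weightMeasure] at h
    have e1 : ∫ x : Ball d, radialPart p.2 x * φ x ∂(lebesgue d) = _ :=
      integral_congr_ae ((ae_lebesgue_mem hd).mono fun x hx =>
        (mul_comm _ _).trans (hkey p.2 x hx).symm)
    have e2 : ∫ x : Ball d, p.1 x * radialDiv φ x ∂(lebesgue d) =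
        ∫ x : Ball d, weight μ (x : Space d) • (p.1 x * ((weight μ (x : Space d))⁻¹ *
          radialDiv φ x)) ∂(lebesgue d) := by
      refine integral_congr_ae ((ae_lebesgue_mem hd).mono fun x hx => ?_)
      have hw := (weight_pos μ hx.1).ne'
      simp only [smul_eq_mul]
      field_simp
    simp only [radialDiv] at e2
    rw [e1, e2]
    simp only [smul_eq_mul, radialDiv] at h ⊢
    linarith
  · rw [integral_weightMeasure]
    refine Eq.trans ?_ (integral_radialPart_smoothGrad hd hf hφ)
    refine integral_congr_ae ((ae_lebesgue_mem hd).mono fun x hx => ?_)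
    have hw := (weight_pos μ hx.1).ne'
    simp only [smul_eq_mul, mul_add, hkey (smoothGrad f) x hx]
    field_simp

/-- The spherical gradient of a function in the domain of the closed weighted gradient. -/
theorem hasSphGrad_of_mem (hd : 2 ≤ d) (hμ : -(1 / 2) < μ)
    {p : L2 d μ × Lp (GradSpace d) 2 (weightMeasure d μ)} (hp : p ∈ gradGraph d μ) :
    HasSphGrad p.1 (sphPart p.2) := by
  have := isFiniteMeasure_weightMeasure hd hμ
  refine ⟨isL2Loc_of_memLp (Lp.memLp p.1), isL2Loc_sphPart p.2, fun φ hφ => ?_⟩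
  have i1 := hφ.integrable_self_smul (isL2Loc_sphPart p.2)
  have i2 := hφ.integrable_smul' hφ.continuousOn_sphDiv (fun _ => sphDiv_eq_zero)
    (isL2Loc_of_memLp (Lp.memLp p.1))
  -- The vector identity is tested against each fixed direction `e`, which reduces it to a scalar
  -- pairing.
  refine ext_inner_left ℝ fun e => ?_
  rw [inner_neg_right, ← integral_inner i1, ← integral_inner (by simpa only [sphDiv] using i2)]
  have hk := (hφ.continuous_of_continuousOn (k := fun x => (WithLp.toLp 2
      ((0 : ℝ), ((weight μ x)⁻¹ * ‖x‖ * φ x) • e) : GradSpace d))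
    ((WithLp.prod_continuous_toLp 2 ℝ (Space d)).comp_continuousOn
      (continuousOn_const.prodMk ((((continuousOn_weight_inv μ).mul
        continuous_norm.continuousOn).mul hφ.1.continuous.continuousOn).smul continuousOn_const)))
    fun x hx => by rw [image_eq_zero_of_notMem_tsupport hx, mul_zero, zero_smul]; rfl).1
  have hl := (hφ.continuous_of_continuousOn
    (k := fun x => (weight μ x)⁻¹ * inner ℝ e (sphDiv φ x))
    ((continuousOn_weight_inv μ).mul (continuousOn_const.inner hφ.continuousOn_sphDiv))
    fun x hx => by rw [sphDiv_eq_zero hx, inner_zero_right, mul_zero]).1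
  have hkey : ∀ Z : Ball d → GradSpace d, ∀ x : Ball d, (x : Space d) ∈ punctured d →
      weight μ (x : Space d) * inner ℝ (WithLp.toLp 2 ((0 : ℝ), ((weight μ (x : Space d))⁻¹ *
        ‖(x : Space d)‖ * φ x) • e) : GradSpace d) (Z x) =
      φ x * inner ℝ e (sphPart Z x) := fun Z x hx => by
    have hw := (weight_pos μ hx.1).ne'
    rw [WithLp.prod_inner_apply]
    simp only [inner_zero_left, zero_add, real_inner_smul_left, real_inner_smul_right, sphPart,
      WithLp.snd]
    field_simp
  have h := integral_pairing_eq_zero hk hl (fun f hf => ?_) hp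
  · rw [integral_weightMeasure, integral_weightMeasure] at h
    have e1 : ∫ x : Ball d, inner ℝ e (φ x • sphPart p.2 x) ∂(lebesgue d) = _ :=
      integral_congr_ae ((ae_lebesgue_mem hd).mono fun x hx =>
        (real_inner_smul_right _ _ _).trans (hkey p.2 x hx).symm)
    have e2 : ∫ x : Ball d, inner ℝ e (p.1 x • sphDiv φ x) ∂(lebesgue d) =
        ∫ x : Ball d, weight μ (x : Space d) • (p.1 x * ((weight μ (x : Space d))⁻¹ *
          inner ℝ e (sphDiv φ x))) ∂(lebesgue d) := by
      refine integral_congr_ae ((ae_lebesgue_mem hd).mono fun x hx => ?_)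
      have hw := (weight_pos μ hx.1).ne'
      simp only [smul_eq_mul, real_inner_smul_right]
      field_simp
    simp only [sphDiv] at e2
    rw [e1, e2]
    simp only [smul_eq_mul, sphDiv] at h ⊢
    linarith
  · rw [integral_weightMeasure]
    refine Eq.trans ?_ (integral_sphPart_smoothGrad hd hf hφ e)
    refine integral_congr_ae ((ae_lebesgue_mem hd).mono fun x hx => ?_)
    have hw := (weight_pos μ hx.1).ne'
    simp only [smul_eq_mul, mul_add, hkey (smoothGrad f) x hx]
    field_simp

/-! ### The domain as the projection of the closed graph -/

theorem weightedRadialDeriv_ae_eq (hd : 2 ≤ d) {f : Ball d → ℝ} {Z : Ball d → GradSpace d}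
    (h : HasRadialDeriv f (radialPart Z)) :
    weightedRadialDeriv f =ᵐ[weightMeasure d μ] fun x => (Z x).fst := by
  have h1 := (hasRadialDeriv_radialDeriv ⟨_, h⟩).unique hd h
  filter_upwards [(weightMeasure_absolutelyContinuous μ).ae_le h1, ae_weightMeasure_mem hd μ]
    with x e1 hx
  have hs : √(1 - ‖(x : Space d)‖ ^ 2) ≠ 0 := (Real.sqrt_pos.2 (one_sub_normSq_pos hx.1)).ne'
  rw [weightedRadialDeriv, e1, radialPart, mul_inv_cancel_left₀ hs]

theorem weightedSphGrad_ae_eq (hd : 2 ≤ d) {f : Ball d → ℝ} {Z : Ball d → GradSpace d}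
    (h : HasSphGrad f (sphPart Z)) :
    weightedSphGrad f =ᵐ[weightMeasure d μ] fun x => (Z x).snd := by
  have h1 := (hasSphGrad_sphGrad ⟨_, h⟩).unique hd h
  filter_upwards [(weightMeasure_absolutelyContinuous μ).ae_le h1, ae_weightMeasure_mem hd μ]
    with x e1 hx
  rw [weightedSphGrad, e1, sphPart, inv_smul_smul₀ (norm_ne_zero_iff.2 hx.2)]

/-- The weighted gradient of a function whose weak derivatives exist. -/
def weightedGrad (f : Ball d → ℝ) (x : Ball d) : GradSpace d :=
  WithLp.toLp 2 (weightedRadialDeriv f x, weightedSphGrad f x)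

theorem energyDensity_eq (f g : Ball d → ℝ) (x : Ball d) :
    energyDensity f g x = inner ℝ (weightedGrad f x) (weightedGrad g x) := by
  have hs := Real.mul_self_sqrt (one_sub_normSq_nonneg x)
  rw [weightedGrad, weightedGrad, WithLp.prod_inner_apply]
  simp only [energyDensity, weightedRadialDeriv, weightedSphGrad, real_inner_smul_left,
    real_inner_smul_right, RCLike.inner_apply, conj_trivial]
  rw [← inv_pow]
  linear_combination (-(radialDeriv f x * radialDeriv g x)) * hs

theorem memLp_weightedGrad {m : Measure (Ball d)} {f : Ball d → ℝ}
    (h1 : MemLp (weightedRadialDeriv f) 2 m) (h2 : MemLp (weightedSphGrad f) 2 m) :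
    MemLp (weightedGrad f) 2 m :=
  (h1.norm.add h2.norm).of_le
    ((WithLp.prod_continuous_toLp 2 ℝ (Space d)).comp_aestronglyMeasurable (h1.1.prodMk h2.1))
    (Eventually.of_forall fun _ => (norm_toLp_le _ _).trans (le_abs_self _))

/-- This is closability: the second component of a pair in the closure is recovered from the first
through the unique weak derivatives. -/
theorem weightedGrad_ae_eq (hd : 2 ≤ d) (hμ : -(1 / 2) < μ) {f : Ball d → ℝ}
    {p : L2 d μ × Lp (GradSpace d) 2 (weightMeasure d μ)} (hp : p ∈ gradGraph d μ)
    (hf : p.1 =ᵐ[weightMeasure d μ] f) :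
    weightedGrad f =ᵐ[weightMeasure d μ] p.2 := by
  have hf' := (lebesgue_absolutelyContinuous hd μ).ae_le hf
  filter_upwards [weightedRadialDeriv_ae_eq hd ((hasRadialDeriv_of_mem hd hμ hp).congr hf'),
    weightedSphGrad_ae_eq hd ((hasSphGrad_of_mem hd hμ hp).congr hf')] with x e1 e2
  rw [weightedGrad, e1, e2]
  rfl

/-- The element of the graph given by a `C²` function. -/
theorem exists_mem_c2Graph [IsFiniteMeasure (weightMeasure d μ)] {f : Space d → ℝ} (hf : IsC2 f) :
    ∃ p ∈ c2Graph d μ, (∀ᵐ x ∂(weightMeasure d μ), p.1 x = f x) ∧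
      ∀ᵐ x ∂(weightMeasure d μ), p.2 x = smoothGrad f x :=
  ⟨(hf.memLp.toLp _, hf.memLp_smoothGrad.toLp _),
    ⟨f, hf, hf.memLp.coeFn_toLp, hf.memLp_smoothGrad.coeFn_toLp⟩, hf.memLp.coeFn_toLp,
    hf.memLp_smoothGrad.coeFn_toLp⟩

theorem c2Graph_le : c2Graph d μ ≤ gradGraph d μ := Submodule.le_topologicalClosure _

/-- A sequence of `C²` functions that converges in the graph is the approximating sequence demanded
by the domain. The differences with the limit stay in the graph, so their weak derivatives are the
differences of the second components. -/
theorem mem_dom_of_mem (hd : 2 ≤ d) (hμ : -(1 / 2) < μ)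
    {p : L2 d μ × Lp (GradSpace d) 2 (weightMeasure d μ)} (hp : p ∈ gradGraph d μ) :
    p.1 ∈ (closedForm d μ).dom := by
  have h1 := hasRadialDeriv_of_mem hd hμ hp
  have h2 := hasSphGrad_of_mem hd hμ hp
  refine ⟨⟨_, h1⟩, ⟨_, h2⟩,
    (memLp_fst (Lp.memLp p.2)).ae_eq (weightedRadialDeriv_ae_eq hd h1).symm,
    (memLp_snd (Lp.memLp p.2)).ae_eq (weightedSphGrad_ae_eq hd h2).symm, ?_⟩
  obtain ⟨s, hs, hlim⟩ := mem_closure_iff_seq_limit.1 hp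
  choose F hF hF1 hF2 using hs
  have l1 : Tendsto (fun n => (s n).1) atTop (𝓝 p.1) := (continuous_fst.tendsto p).comp hlim
  have l2 : Tendsto (fun n => (s n).2) atTop (𝓝 p.2) := (continuous_snd.tendsto p).comp hlim
  rw [Lp.tendsto_Lp_iff_tendsto_eLpNorm'] at l1 l2
  have hsub : ∀ n, s n - p ∈ gradGraph d μ := fun n =>
    (gradGraph d μ).sub_mem (c2Graph_le ⟨F n, hF n, hF1 n, hF2 n⟩) hp
  have hae : ∀ n, (s n - p).1 =ᵐ[weightMeasure d μ] fun x => F n x - p.1 x := fun n => by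
    filter_upwards [hF1 n, Lp.coeFn_sub (s n).1 p.1] with x e1 e2
    rw [Prod.fst_sub, e2, Pi.sub_apply, e1]
  have hgr := fun n => weightedGrad_ae_eq hd hμ (hsub n) (hae n)
  have hle : ∀ n, eLpNorm (weightedGrad fun x : Ball d => F n x - p.1 x) 2 (weightMeasure d μ) =
      eLpNorm ((s n).2 - p.2 : Ball d → GradSpace d) 2 (weightMeasure d μ) := fun n =>
    eLpNorm_congr_ae ((hgr n).trans (Lp.coeFn_sub _ _))
  refine ⟨F, hF, ?_, ?_, ?_⟩
  · refine l1.congr fun n => eLpNorm_congr_ae ((Lp.coeFn_sub _ _).symm.trans (hae n))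
  · refine tendsto_of_tendsto_of_tendsto_of_le_of_le tendsto_const_nhds l2 (fun _ => zero_le)
      fun n => ?_
    simp only
    rw [← hle]
    exact eLpNorm_mono fun x => norm_fst_le (weightedGrad _ x)
  · refine tendsto_of_tendsto_of_tendsto_of_le_of_le tendsto_const_nhds l2 (fun _ => zero_le)
      fun n => ?_
    simp only
    rw [← hle]
    exact eLpNorm_mono fun x => norm_snd_le (weightedGrad _ x)

/-- Conversely, the approximation clause says that the graph elements of the `C²` functions converge
to `u` paired with its own weighted gradient. -/
theorem mem_of_mem_dom (hd : 2 ≤ d) (hμ : -(1 / 2) < μ) {u : L2 d μ}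
    (hu : u ∈ (closedForm d μ).dom) : ∃ Z, (u, Z) ∈ gradGraph d μ := by
  have := isFiniteMeasure_weightMeasure hd hμ
  obtain ⟨hr, hs, hmr, hms, F, hF, l1, l2, l3⟩ := hu
  have hZ := memLp_weightedGrad hmr hms
  choose p hpG hp1 hp2 using fun n => exists_mem_c2Graph (μ := μ) (hF n)
  refine ⟨hZ.toLp _, ?_⟩
  refine mem_closure_iff_seq_limit.2 ⟨p, hpG, Prod.tendsto_iff _ _ |>.2 ⟨?_, ?_⟩⟩
  · rw [Lp.tendsto_Lp_iff_tendsto_eLpNorm']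
    refine l1.congr fun n => eLpNorm_congr_ae ?_
    filter_upwards [hp1 n] with x e1
    rw [Pi.sub_apply, e1]
  · rw [Lp.tendsto_Lp_iff_tendsto_eLpNorm']
    have l4 := l2.add l3
    rw [add_zero] at l4
    refine tendsto_of_tendsto_of_tendsto_of_le_of_le tendsto_const_nhds l4 (fun _ => zero_le)
      fun n => ?_
    have hp := c2Graph_le (hpG n)
    have hae := (lebesgue_absolutelyContinuous hd μ).ae_le (hp1 n)
    -- The hypotheses concern the selected weak derivative of `F n - u`. Linearity produces one
    -- explicitly, as a difference, and uniqueness identifies the two.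
    have d1 := (((hasRadialDeriv_of_mem hd hμ hp).congr hae).sub (hasRadialDeriv_radialDeriv hr))
    have d2 := (((hasSphGrad_of_mem hd hμ hp).congr hae).sub (hasSphGrad_sphGrad hs))
    have c1 := (weightMeasure_absolutelyContinuous μ).ae_le
      ((hasRadialDeriv_radialDeriv ⟨_, d1⟩).unique hd d1)
    have c2 := (weightMeasure_absolutelyContinuous μ).ae_le
      ((hasSphGrad_sphGrad ⟨_, d2⟩).unique hd d2)
    have hae2 : ((p n).2 - hZ.toLp _ : Ball d → GradSpace d) =ᵐ[weightMeasure d μ]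
        weightedGrad fun x => F n x - u x := by
      filter_upwards [c1, c2, hZ.coeFn_toLp, ae_weightMeasure_mem hd μ] with x e1 e2 e3 hx
      have hs0 : √(1 - ‖(x : Space d)‖ ^ 2) ≠ 0 :=
        (Real.sqrt_pos.2 (one_sub_normSq_pos hx.1)).ne'
      rw [Pi.sub_apply, e3]
      refine WithLp.ofLp_injective 2 (Prod.ext ?_ ?_)
      · change ((p n).2 x).fst - weightedRadialDeriv u x = weightedRadialDeriv _ x
        rw [weightedRadialDeriv, weightedRadialDeriv, e1, radialPart, mul_sub,
          mul_inv_cancel_left₀ hs0]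
      · change ((p n).2 x).snd - weightedSphGrad u x = weightedSphGrad _ x
        rw [weightedSphGrad, weightedSphGrad, e2, sphPart, smul_sub,
          inv_smul_smul₀ (norm_ne_zero_iff.2 hx.2)]
    simp only
    rw [eLpNorm_congr_ae hae2]
    have m1 : AEStronglyMeasurable (weightedRadialDeriv fun x : Ball d => F n x - u x)
        (weightMeasure d μ) := by
      have := (memLp_fst ((Lp.memLp (p n).2).sub hZ)).1
      refine this.congr ?_
      filter_upwards [hae2, hZ.coeFn_toLp] with x e1 e2
      rw [Pi.sub_apply, e2] at e1
      rw [Pi.sub_apply, e1]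
      rfl
    have m2 : AEStronglyMeasurable (weightedSphGrad fun x : Ball d => F n x - u x)
        (weightMeasure d μ) := by
      have := (memLp_snd ((Lp.memLp (p n).2).sub hZ)).1
      refine this.congr ?_
      filter_upwards [hae2, hZ.coeFn_toLp] with x e1 e2
      rw [Pi.sub_apply, e2] at e1
      rw [Pi.sub_apply, e1]
      rfl
    refine (eLpNorm_mono_real fun x => norm_toLp_le _ _).trans ?_
    refine (eLpNorm_add_le m1.norm m2.norm one_le_two).trans ?_
    rw [eLpNorm_norm, eLpNorm_norm]

theorem energyDensity_ae_eq (hd : 2 ≤ d) (hμ : -(1 / 2) < μ) {u v : L2 d μ}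
    {Z Y : Lp (GradSpace d) 2 (weightMeasure d μ)} (hu : (u, Z) ∈ gradGraph d μ)
    (hv : (v, Y) ∈ gradGraph d μ) :
    energyDensity u v =ᵐ[weightMeasure d μ] fun x => inner ℝ (Z x) (Y x) := by
  filter_upwards [weightedGrad_ae_eq hd hμ hu (ae_eq_refl _),
    weightedGrad_ae_eq hd hμ hv (ae_eq_refl _)] with x e1 e2
  rw [energyDensity_eq, e1, e2]

/-- Composition with a `C²` function preserves `C²(B)`, which is why the abstract chain rule asks
for that class. -/
theorem stableComp_c2Graph [IsFiniteMeasure (weightMeasure d μ)] {φ : ℝ → ℝ}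
    (hφ : ContDiff ℝ 2 φ) :
    PartialForm.StableComp φ (deriv φ)
      (c2Graph d μ : Set (L2 d μ × Lp (GradSpace d) 2 (weightMeasure d μ))) := by
  rintro p ⟨f, hf, h1, h2⟩
  obtain ⟨q, hq, q1, q2⟩ := exists_mem_c2Graph (μ := μ) (f := fun y => φ (f y))
    (hφ.comp_contDiffOn hf)
  refine ⟨q, hq, ?_, ?_⟩
  · filter_upwards [h1, q1] with x e1 e2
    rw [e2, e1]
  · filter_upwards [h1, h2, q2] with x e1 e2 e3
    rw [e3, e1, e2, smoothGrad_comp hφ hf]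

/-- This brings the concrete form under the abstract theory; the bound on the derivative is what
carries the chain rule to the closure. -/
theorem isGradientForm_closedForm (hd : 2 ≤ d) (hμ : -(1 / 2) < μ) :
    (closedForm d μ).IsGradientForm (gradGraph d μ) where
  closed := Submodule.isClosed_topologicalClosure _
  mem_dom u := ⟨mem_of_mem_dom hd hμ, fun ⟨_, hZ⟩ => mem_dom_of_mem hd hμ hZ⟩
  val_eq hu hv := by
    rw [L2.inner_def]
    exact integral_congr_ae (energyDensity_ae_eq hd hμ hu hv)
  comp φ hφ := by
    rintro ⟨C, hC⟩
    have := isFiniteMeasure_weightMeasure hd hμ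
    exact (stableComp_c2Graph hφ).closure
      (fun t => (hφ.differentiable (by norm_num) t).hasDerivAt)
      (hφ.continuous_deriv (by norm_num)) hC

/-- The restrictions of `C²` functions to the ball. -/
def c2Subalgebra (d : ℕ) : Subalgebra ℝ C(Ball d, ℝ) where
  carrier := {φ | ∃ f : Space d → ℝ, IsC2 f ∧ ∀ x : Ball d, φ x = f x}
  mul_mem' := by
    rintro φ ψ ⟨f, hf, h1⟩ ⟨g, hg, h2⟩
    exact ⟨fun y => f y * g y, ContDiffOn.mul hf hg, fun x => by
      rw [ContinuousMap.mul_apply, h1, h2]⟩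
  add_mem' := by
    rintro φ ψ ⟨f, hf, h1⟩ ⟨g, hg, h2⟩
    exact ⟨fun y => f y + g y, ContDiffOn.add hf hg, fun x => by
      rw [ContinuousMap.add_apply, h1, h2]⟩
  algebraMap_mem' r := ⟨fun _ => r, contDiffOn_const, fun _ => rfl⟩

/-! ### Density of `C²(B)` and regularity -/

theorem exists_isC2_near (φ : C(Ball d, ℝ)) {ε : ℝ} (hε : 0 < ε) :
    ∃ f : Space d → ℝ, IsC2 f ∧ ∀ x : Ball d, |f x - φ x| < ε := by
  -- The coordinate functions are of class `C²` and separate points.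
  have hsep : (c2Subalgebra d).SeparatesPoints := by
    intro x y hxy
    have hne : ∃ i, (x : Space d) i ≠ (y : Space d) i := by
      by_contra! h
      exact hxy (Subtype.ext (PiLp.ext h))
    obtain ⟨i, hi⟩ := hne
    refine ⟨fun z : Ball d => (z : Space d) i, ⟨⟨fun z : Ball d => (z : Space d) i, by fun_prop⟩,
      ⟨fun z => z i, ?_, fun _ => rfl⟩, rfl⟩, hi⟩
    exact (EuclideanSpace.proj (𝕜 := ℝ) i).contDiff.contDiffOn
  obtain ⟨⟨ψ, f, hf, hψ⟩, hn⟩ :=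
    ContinuousMap.exists_mem_subalgebra_near_continuousMap_of_separatesPoints
      (c2Subalgebra d) hsep φ ε hε
  refine ⟨f, hf, fun x => ?_⟩
  have := (ContinuousMap.norm_lt_iff _ hε).1 hn x
  simpa [hψ] using this

/-- Continuous functions are dense in `L²` of a finite measure, and `C²` functions are uniformly
dense among them. -/
theorem dense_preForm_dom (hd : 2 ≤ d) (hμ : -(1 / 2) < μ) : Dense (preForm d μ).dom := by
  have := isFiniteMeasure_weightMeasure hd hμ
  intro u
  refine Metric.mem_closure_iff.2 fun ε hε => ?_
  obtain ⟨φ, hφ⟩ := Metric.denseRange_iff.1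
    (ContinuousMap.toLp_denseRange (p := 2) ℝ (weightMeasure d μ) ℝ ENNReal.ofNat_ne_top) u (ε / 2)
    (by positivity)
  set T := ContinuousMap.toLp (E := ℝ) 2 (weightMeasure d μ) ℝ with hT
  -- The summand `1` guards against division by zero if the embedding has norm zero.
  have hδ : 0 < ε / 2 / (‖T‖ + 1) := by positivity
  obtain ⟨f, hf, hfφ⟩ := exists_isC2_near φ hδ
  let ψ : C(Ball d, ℝ) := ⟨fun x => f x, continuous_ball (ContDiffOn.continuousOn hf)⟩
  refine ⟨T ψ, ⟨f, hf, ContinuousMap.coeFn_toLp (weightMeasure d μ) ψ⟩, ?_⟩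
  have h1 : dist (T φ) (T ψ) < ε / 2 := by
    have h2 : ‖φ - ψ‖ < ε / 2 / (‖T‖ + 1) := by
      rw [ContinuousMap.norm_lt_iff _ hδ]
      intro x
      rw [ContinuousMap.sub_apply, norm_sub_rev]
      exact hfφ x
    rw [dist_eq_norm, ← map_sub]
    refine (T.le_opNorm _).trans_lt ?_
    rw [lt_div_iff₀ (by positivity)] at h2
    nlinarith [norm_nonneg (φ - ψ), norm_nonneg T]
  linarith [dist_triangle u (T φ) (T ψ)]

theorem exists_c2Rep_near (hd : 2 ≤ d) (hμ : -(1 / 2) < μ) {u : L2 d μ}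
    (hu : u ∈ (closedForm d μ).dom) {ε : ℝ} (hε : 0 < ε) :
    ∃ v ∈ (preForm d μ).dom, (closedForm d μ).normSq (u - v) < ε := by
  have hG := isGradientForm_closedForm hd hμ
  obtain ⟨Z, hZ⟩ := mem_of_mem_dom hd hμ hu
  -- The product carries the maximum norm, so each of the two squared norms falls below `ε / 2`.
  obtain ⟨q, hq, hdist⟩ := Metric.mem_closure_iff.1 hZ (√(ε / 2)) (by positivity)
  obtain ⟨f, hf, h1, h2⟩ := hq
  refine ⟨q.1, ⟨f, hf, h1⟩, ?_⟩
  have hsub : (u - q.1, Z - q.2) ∈ gradGraph d μ :=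
    (gradGraph d μ).sub_mem hZ (c2Graph_le ⟨f, hf, h1, h2⟩)
  rw [hG.normSq_eq hsub]
  rw [dist_eq_norm, Prod.norm_def, max_lt_iff] at hdist
  have a1 : ‖u - q.1‖ ^ 2 < ε / 2 := (Real.lt_sqrt (norm_nonneg _)).1 hdist.1
  have a2 : ‖Z - q.2‖ ^ 2 < ε / 2 := (Real.lt_sqrt (norm_nonneg _)).1 hdist.2
  linarith

theorem preForm_dom_subset (hd : 2 ≤ d) (hμ : -(1 / 2) < μ) :
    (preForm d μ).dom ⊆ (closedForm d μ).dom := by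
  rintro u ⟨f, hf, hu⟩
  have := isFiniteMeasure_weightMeasure hd hμ
  refine mem_dom_of_mem hd hμ (p := (u, hf.memLp_smoothGrad.toLp _)) (c2Graph_le ?_)
  exact ⟨f, hf, hu, hf.memLp_smoothGrad.coeFn_toLp⟩

/-- Green's formula holds for every `C²` representative, in particular for the one selected in the
definition of `preForm`. -/
theorem closedForm_val_eq_preForm (hd : 2 ≤ d) (hμ : -(1 / 2) < μ) {u v : L2 d μ}
    (hu : u ∈ (preForm d μ).dom) (hv : v ∈ (preForm d μ).dom) :
    (closedForm d μ).val u v = (preForm d μ).val u v := by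
  have := isFiniteMeasure_weightMeasure hd hμ
  have hG := isGradientForm_closedForm hd hμ
  obtain ⟨hf, hfu⟩ := Exists.choose_spec hu
  obtain ⟨g, hg, hgv⟩ := hv
  have huG : (u, hf.memLp_smoothGrad.toLp _) ∈ gradGraph d μ :=
    c2Graph_le ⟨_, hf, hfu, hf.memLp_smoothGrad.coeFn_toLp⟩
  have hvG : (v, hg.memLp_smoothGrad.toLp _) ∈ gradGraph d μ :=
    c2Graph_le ⟨_, hg, hgv, hg.memLp_smoothGrad.coeFn_toLp⟩
  have hval : (preForm d μ).val u v =
      ∫ x, diffOp μ hu.choose (x : Space d) * v x ∂(weightMeasure d μ) := dif_pos hu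
  rw [hG.val_eq huG hvG, hval, L2.inner_def]
  have e1 : ∫ x, diffOp μ hu.choose (x : Space d) * v x ∂(weightMeasure d μ) =
      ∫ x : Ball d, diffOp μ hu.choose (x : Space d) * g x ∂(weightMeasure d μ) := by
    refine integral_congr_ae ?_
    filter_upwards [hgv] with x hx
    rw [hx]
  rw [e1, integral_diffOp_mul hd hμ hf hg]
  refine integral_congr_ae ?_
  filter_upwards [hf.memLp_smoothGrad.coeFn_toLp, hg.memLp_smoothGrad.coeFn_toLp] with x e1 e2
  rw [e1, e2]

theorem isRegular_closedForm (hd : 2 ≤ d) (hμ : -(1 / 2) < μ) : (closedForm d μ).IsRegular where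
  dense_dom u hu ε hε := by
    obtain ⟨v, hv, hlt⟩ := exists_c2Rep_near hd hμ hu hε
    obtain ⟨f, hf, hfv⟩ := hv
    exact ⟨v, fun x => f x, ⟨preForm_dom_subset hd hμ ⟨f, hf, hfv⟩,
      continuous_ball (ContDiffOn.continuousOn hf), HasCompactSupport.of_compactSpace _, hfv⟩, hlt⟩
  dense_continuous φ hφ _ ε hε := by
    have := isFiniteMeasure_weightMeasure hd hμ
    obtain ⟨f, hf, hfφ⟩ := exists_isC2_near ⟨φ, hφ⟩ hε
    refine ⟨hf.memLp.toLp _, fun x => f x, ⟨preForm_dom_subset hd hμ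
      ⟨f, hf, hf.memLp.coeFn_toLp⟩, continuous_ball (ContDiffOn.continuousOn hf),
      HasCompactSupport.of_compactSpace _, hf.memLp.coeFn_toLp⟩, fun x => ?_⟩
    rw [abs_sub_comm]
    exact hfφ x

end UnitBall

end

/-! ### The theorem -/

theorem lemma2 (d : ℕ) (hd : 2 ≤ d) (μ : ℝ) (hμ : -(1 / 2) < μ) :
    (UnitBall.closedForm d μ).IsClosureOf (UnitBall.preForm d μ) ∧
    (UnitBall.closedForm d μ).IsDirichletForm ∧
    (UnitBall.closedForm d μ).IsRegular ∧
    (UnitBall.closedForm d μ).IsStronglyLocal ∧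
    ∀ f ∈ (UnitBall.closedForm d μ).dom, ∀ g ∈ (UnitBall.closedForm d μ).dom,
      MeasureTheory.Integrable (UnitBall.energyDensity f g) (UnitBall.weightMeasure d μ) ∧
      (UnitBall.closedForm d μ).IsMutualEnergyMeasure f g
        ((UnitBall.weightMeasure d μ).withDensityᵥ (UnitBall.energyDensity f g)) ∧
      (UnitBall.closedForm d μ).val f g =
        ∫ x, UnitBall.energyDensity f g x ∂(UnitBall.weightMeasure d μ) := by
  have := UnitBall.isFiniteMeasure_weightMeasure hd hμ
  have hG := UnitBall.isGradientForm_closedForm hd hμ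
  have hdense : Dense (UnitBall.closedForm d μ).dom :=
    (UnitBall.dense_preForm_dom hd hμ).mono (UnitBall.preForm_dom_subset hd hμ)
  refine ⟨⟨hG.isSymmetricForm hdense, hG.isClosedForm, UnitBall.preForm_dom_subset hd hμ,
      fun u hu v hv => UnitBall.closedForm_val_eq_preForm hd hμ hu hv,
      fun u hu ε hε => UnitBall.exists_c2Rep_near hd hμ hu hε⟩,
    hG.isDirichletForm hdense, UnitBall.isRegular_closedForm hd hμ, hG.isStronglyLocal,
    fun f hf g hg => ?_⟩
  obtain ⟨Z, hZ⟩ := UnitBall.mem_of_mem_dom hd hμ hf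
  obtain ⟨Y, hY⟩ := UnitBall.mem_of_mem_dom hd hμ hg
  have hae := UnitBall.energyDensity_ae_eq hd hμ hZ hY
  refine ⟨(MeasureTheory.L2.integrable_inner Z Y).congr hae.symm, ?_, rfl⟩
  -- The energy density agrees almost everywhere with the inner product of the graph gradients, for
  -- which the mutual energy measure is known.
  rw [MeasureTheory.WithDensityᵥEq.congr_ae hae]
  exact hG.isMutualEnergyMeasure hZ hY
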